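/- **Theorem (reduction of order).** Let $n\ge 1$. Write $(x,y,y_1,\dots,y_n)$ for the coordinates of the jet space $J^n=\mathbb R^{n+2}$. Let $\mathsf E$ be a smooth real function on an open set $\Omega\subseteq J^n$ with $\partial \mathsf E/\partial y_n\neq 0$ wherever $\mathsf E=0$. A *solution* of $\mathsf E=0$ is a $C^n$ function $f$ on a nonempty open interval $I$ whose jets $(x,f(x),\dots,f^{(n)}(x))$, $x\in I$, lie in $\Omega$ and satisfy $\mathsf E=0$. Let $G=\{\Phi_\varepsilon\}$ be a smooth local one-parameter group of transformations of an open set $M\subseteq\mathbb R^2$ that contains the points $(x,y)$ of all jets in $\Omega$, and let $\mathbf v=\frac{d}{d\varepsilon}\big|_{\varepsilon=0}\Phi_\varepsilon$ be its generator. Assume that $G$ is a symmetry group of the equation: if $f$ is a solution on $I$ and $x_0\in I$, then there is an open interval $I'\ni x_0$ in $I$ such that for all sufficiently small $\varepsilon$ the map $\Phi_\varepsilon$ is defined on the graph of $f|_{I'}$ and takes it to the graph of a solution. Then: 1. Near every point of $M$ where $\mathbf v\ne 0$ there are rectifying coordinates $(r,s)$, that is, smooth local coordinates with $\mathbf v(r)=0$,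 $\mathbf v(s)=1$ (so $\mathbf v=\partial_s$). 2. Let $(r,s)$ be any rectifying coordinates on an open set $U\subseteq M$. For a jet over $U$ that is transverse to $\mathbf v$ (i.e. $\mathbf v$ is not a multiple of $(1,y_1)$) let $z_i=d^{\,i+1}s/dr^{\,i+1}$ $(0\le i\le n-1)$ be defined by $\frac{d^0s}{dr^0}=s$, $\frac{d^{k+1}s}{dr^{k+1}}=\frac{D_x(d^ks/dr^k)}{D_xr}$, where $D_x$ is the total derivative. Call a pair $(D,J)$, with $D\subseteq\mathbb R^{n+1}$ open and $J\subseteq\mathbb R$ a nonempty open interval, a *reduction domain* if every $(r,s,z_0,\dots,z_{n-1})$ with $(r,z_0,\dots,z_{n-1})\in D$ and $s\in J$ comes from a jet in $\Omega$ over $U$ transverse to $\mathbf v$. Every jet in $\Omega$ over $U$ transverse to $\mathbf v$ has its coordinates in some reduction domain. 3. For every reduction domain $(D,J)$ there is a reduced equation $R(r,z_0,\dots,z_{n-1})=0$ of order $n-1$ for $z=z(r)$, with $R$ smooth on $D$ and $\partial R/\partial z_{n-1}\ne0$ wherever $R=0$, such that: - (a) a jet in $\Omega$ over $U$, transverse to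 $\mathbf v$, with $(r,z_0,\dots,z_{n-1})\in D$ and $s\in J$, satisfies $\mathsf E=0$ if and only if $R(r,z_0,\dots,z_{n-1})=0$; so in the coordinates $(r,s)$ the equation does not involve $s$; - (b) if $f$ is a solution of $\mathsf E=0$ on $I$ with graph in $U$ to which $\mathbf v$ is nowhere tangent, then $\rho(x)=r(x,f(x))$ is injective on $I$ and there is a $C^{n-1}$ function $\vartheta$ on $\rho(I)$ such that $(\rho(x),\vartheta(\rho(x)),\dots,\vartheta^{(n-1)}(\rho(x)))$ is the tuple $(r,z_0,\dots,z_{n-1})$ of the jet of $f$ at $x$; $\vartheta$ is a solution of $R=0$ on $\rho(I')$ for every nonempty open interval $I'\subseteq I$ over which the jets of $f$ have $(r,z_0,\dots,z_{n-1})\in D$ and $s\in J$; and, for each $x_1\in I$, the graph of $f$ is recovered by one quadrature: in the coordinates $(r,s)$ it is the curve $s=s(x_1,f(x_1))+\int_{\rho(x_1)}^{r}\vartheta(t)\,dt$, $r\in\rho(I)$; - (c) conversely, if $\vartheta$ is a solution of $R=0$ on an open interval $K$, $r_1\in K$, $c\in\mathbb R$, and $\sigma(r)=c+\int_{r_1}^r\vartheta(t)\,dt$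 has values in $J$ on $K$, then the curve $s=\sigma(r)$, $r\in K$, lies in the image of the coordinates $(r,s)$ and is, in the coordinates $(x,y)$, the graph of a solution of $\mathsf E=0$ to which $\mathbf v$ is nowhere tangent. (For $n=1$ the reduced equation is an equation $R(r,z)=0$ without derivatives.) -/

import Mathlib

open Set Filter Topology
open scoped ContDiff

namespace ODEReduction

/-- The jet space `J^k` of one independent and one dependent variable: the point
`(x, (y, y₁, …, y_k))` is encoded as `q` with `q.1 = x` and `q.2 i = y_i`, `y_0 = y`. -/
abbrev Jet (k : ℕ) : Type := ℝ × (Fin (k + 1) → ℝ)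

/-- The underlying point `(x, y)` of the plane. -/
def Jet.base {k : ℕ} (q : Jet k) : ℝ × ℝ := (q.1, q.2 0)

/-- The projection `J^m → J^k`, `k ≤ m`, forgetting the derivatives of order `> k`. -/
def Jet.restrict {m k : ℕ} (q : Jet m) (h : k + 1 ≤ m + 1) : Jet k :=
  (q.1, fun i => q.2 (Fin.castLE h i))

/-- The `k`-jet `(x, f(x), f'(x), …, f^{(k)}(x))` of a function. -/
noncomputable def jet (k : ℕ) (f : ℝ → ℝ) (x : ℝ) : Jet k :=
  (x, fun i => iteratedDeriv (i : ℕ) f x)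

/-- The total derivative `D_x F = F_x + ∑_{i ≤ k} y_{i+1} F_{y_i}`, a function on `J^{k+1}`,
of a differential function `F` on `J^k`. -/
noncomputable def totalDeriv {k : ℕ} (F : Jet k → ℝ) (q : Jet (k + 1)) : ℝ :=
  fderiv ℝ F (q.restrict (Nat.le_succ _)) (1, fun i => q.2 i.succ)

/-- `E = 0` is a scalar ordinary differential equation of order `k`: `E` is smooth on the open
subset `Ω` of `J^k`, and `∂E/∂y_k ≠ 0` at the points satisfying the equation.
For `k = 0` this is a (regular) equation `E(x, y) = 0` without derivatives. -/
structure IsODE (k : ℕ) (Ω : Set (Jet k)) (E : Jet k → ℝ) : Prop where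
  isOpen : IsOpen Ω
  smooth : ContDiffOn ℝ ∞ E Ω
  regular : ∀ q ∈ Ω, E q = 0 → fderiv ℝ E q (0, Pi.single (Fin.last k) 1) ≠ 0

/-- `f` is a (classical) solution of the equation `E = 0` of order `k` on the open interval `I`
(possibly unbounded). -/
structure IsSolution (k : ℕ) (Ω : Set (Jet k)) (E : Jet k → ℝ) (I : Set ℝ) (f : ℝ → ℝ) :
    Prop where
  isOpen : IsOpen I
  isConnected : IsConnected I
  contDiffOn : ContDiffOn ℝ k f I
  mem : ∀ x ∈ I, jet k f x ∈ Ω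
  eq_zero : ∀ x ∈ I, E (jet k f x) = 0

/-- A smooth local one-parameter group of transformations `Φ_ε` of the open subset `M` of the
plane; `dom` is the set of the pairs `(ε, p)` for which `Φ_ε(p)` is defined. -/
structure IsLocalOneParameterGroup (M : Set (ℝ × ℝ)) (dom : Set (ℝ × (ℝ × ℝ)))
    (Φ : ℝ → ℝ × ℝ → ℝ × ℝ) : Prop where
  isOpen_space : IsOpen M
  isOpen_dom : IsOpen dom
  mem_space : ∀ ε p, (ε, p) ∈ dom → p ∈ M
  zero_mem : ∀ p ∈ M, ((0 : ℝ), p) ∈ dom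
  interval : ∀ p ∈ M, {ε : ℝ | (ε, p) ∈ dom}.OrdConnected
  smooth : ContDiffOn ℝ ∞ (fun z : ℝ × (ℝ × ℝ) => Φ z.1 z.2) dom
  mapsTo : ∀ ε p, (ε, p) ∈ dom → Φ ε p ∈ M
  map_zero : ∀ p ∈ M, Φ 0 p = p
  map_add : ∀ δ ε p, (ε, p) ∈ dom → (δ, Φ ε p) ∈ dom → (δ + ε, p) ∈ dom →
    Φ δ (Φ ε p) = Φ (δ + ε) p
  map_neg : ∀ ε p, (ε, p) ∈ dom → (-ε, Φ ε p) ∈ dom ∧ Φ (-ε) (Φ ε p) = p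

/-- `v` is the infinitesimal generator of the local one-parameter group `Φ` of `M`. -/
def IsGenerator (M : Set (ℝ × ℝ)) (Φ : ℝ → ℝ × ℝ → ℝ × ℝ) (v : ℝ × ℝ → ℝ × ℝ) : Prop :=
  ∀ p ∈ M, HasDerivAt (fun ε => Φ ε p) (v p) 0

/-- The local one-parameter group `Φ` is a symmetry group of the equation `E = 0` of order `k`:
it maps solutions to solutions, acting on functions through their graphs. As the group is local,
this is only asked, for a solution `f` near any point of its interval `I`, for the group
parameters `ε` that are small enough (depending on `f` and on the point). -/
def IsSymmetryGroup (k : ℕ) (Ω : Set (Jet k)) (E : Jet k → ℝ) (dom : Set (ℝ × (ℝ × ℝ)))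
    (Φ : ℝ → ℝ × ℝ → ℝ × ℝ) : Prop :=
  ∀ (I : Set ℝ) (f : ℝ → ℝ), IsSolution k Ω E I f → ∀ x₀ ∈ I,
    ∃ I' ⊆ I, IsOpen I' ∧ IsConnected I' ∧ x₀ ∈ I' ∧
      ∀ᶠ ε in 𝓝 (0 : ℝ), (∀ p ∈ graphOn f I', (ε, p) ∈ dom) ∧
        ∃ (I₁ : Set ℝ) (f₁ : ℝ → ℝ),
          graphOn f₁ I₁ = Φ ε '' graphOn f I' ∧ IsSolution k Ω E I₁ f₁

/-- `v` is nowhere tangent to the graph of `f` over `I`. -/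
def NowhereTangent (v : ℝ × ℝ → ℝ × ℝ) (I : Set ℝ) (f : ℝ → ℝ) : Prop :=
  ∀ x ∈ I, ∀ c : ℝ, v (x, f x) ≠ c • ((1 : ℝ), deriv f x)

/-- `v` is not tangent to the graphs through the jet `q`, whose tangent there is `(1, y₁)`. -/
def Transverse {n : ℕ} (v : ℝ × ℝ → ℝ × ℝ) (q : Jet (n + 1)) : Prop :=
  ∀ c : ℝ, v q.base ≠ c • ((1 : ℝ), q.2 1)

/-- `φ = (r, s)` are rectifying coordinates for `v` on the open set `φ.source ⊆ M`: a smooth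
change of coordinates, with smooth inverse, such that `v(r) = 0` and `v(s) = 1`,
i.e. `v = ∂_s`. -/
structure IsRectifyingChart (M : Set (ℝ × ℝ)) (v : ℝ × ℝ → ℝ × ℝ)
    (φ : OpenPartialHomeomorph (ℝ × ℝ) (ℝ × ℝ)) : Prop where
  source_subset : φ.source ⊆ M
  smooth : ContDiffOn ℝ ∞ φ φ.source
  smooth_symm : ContDiffOn ℝ ∞ φ.symm φ.target
  rectifies : ∀ p ∈ φ.source, fderiv ℝ φ p (v p) = (0, 1)

/-- The derivative `d^k s / dr^k` in the coordinates `φ = (r, s)`, as a function on `J^k`: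
`d^0 s / dr^0 = s(x, y)` and `d^{k+1} s / dr^{k+1} = D_x (d^k s / dr^k) / D_x r`. -/
noncomputable def sDeriv (φ : ℝ × ℝ → ℝ × ℝ) : (k : ℕ) → Jet k → ℝ
  | 0, q => (φ q.base).2
  | k + 1, q => totalDeriv (sDeriv φ k) q /
      totalDeriv (fun p : Jet 0 => (φ p.base).1) (q.restrict (by omega) : Jet 1)

/-- For a jet `q` of order `n + 1`, the jet `(r, (z, z₁, …, z_n))` of order `n`, where
`z = ds/dr` and `z_i = d^i z / dr^i = d^{i+1} s / dr^{i+1}`. -/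
noncomputable def reducedJet {n : ℕ} (φ : ℝ × ℝ → ℝ × ℝ) (q : Jet (n + 1)) : Jet n :=
  ((φ q.base).1, fun i => sDeriv φ (i + 1) (q.restrict (by omega)))

/-- The open set `D` of jets `w = (r, (z, z₁, …, z_n))` and the open interval `J` of values of
`s` are such that all `(r, s, z, …, z_n)` with `w ∈ D` and `s ∈ J` are the `(r, s)`-coordinates
of a jet that belongs to the domain `Ω` of the equation and is transverse to `v`. -/
structure IsReductionDomain {n : ℕ} (Ω : Set (Jet (n + 1))) (v : ℝ × ℝ → ℝ × ℝ)
    (φ : OpenPartialHomeomorph (ℝ × ℝ) (ℝ × ℝ)) (D : Set (Jet n)) (J : Set ℝ) : Prop where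
  isOpen : IsOpen D
  isOpen_interval : IsOpen J
  isConnected : IsConnected J
  exists_jet : ∀ w ∈ D, ∀ s ∈ J, ∃ q ∈ Ω, q.base ∈ φ.source ∧ Transverse v q ∧
    (φ q.base).2 = s ∧ reducedJet φ q = w

end ODEReduction

open ODEReduction

/-!
Smooth coordinates `φ = (r, s)` act on the jets along which `D_x r ≠ 0`: the jet of `f` at `x` goes
to the jet of the function whose graph is the image under `φ` of the graph of `f`. Since jets of
functions fill the jet space, this description of `prolong φ` shows that prolongation by `φ.symm`
is its inverse. Moreover the coordinates of order `< k` of a prolonged jet do not depend on `y_k`,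
so an invertible prolongation preserves the direction `∂/∂y_k`; hence an equation that is regular
in the highest derivative remains so in the coordinates `(r, s)`.

A symmetry acts on solutions, so to draw conclusions about single jets one needs that every jet
with `E = 0` is the jet of a solution. The solutions are the integral curves of the vector field
`∂_x + y₁ ∂_y + ⋯ + y_k ∂_{y_{k-1}} + F ∂_{y_k}`, where `F` is chosen to make it tangent to the
level sets of `E`. In rectifying coordinates the group is translation in `s`, so the zero set of
`E` is locally invariant under these translations, and on an interval of values of `s` locally
invariant means invariant. The reduced equation is therefore `E` at any frozen value of `s`,
an equation for `z = ds/dr`, and `s` is the integral of `z`.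
-/

namespace ODEReduction

/-! ### Local inverses and charts -/

section Charts

variable {E F : Type*} [NormedAddCommGroup E] [NormedSpace ℝ E] [NormedAddCommGroup F]
  [NormedSpace ℝ F]

theorem leftInverse_fderiv_of_eventually {f : E → F} {g : F → E} {p : E}
    (hf : DifferentiableAt ℝ f p) (hg : DifferentiableAt ℝ g (f p))
    (h : ∀ᶠ x in 𝓝 p, g (f x) = x) :
    Function.LeftInverse (fderiv ℝ g (f p)) (fderiv ℝ f p) :=
  DFunLike.congr_fun <| (hg.hasFDerivAt.comp p hf.hasFDerivAt).unique <|
    (hasFDerivAt_id p).congr_of_eventuallyEq h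

/-- A smooth change of coordinates: an open partial homeomorphism that is smooth in both
directions. -/
structure IsSmoothChart (φ : OpenPartialHomeomorph E F) : Prop where
  smooth : ContDiffOn ℝ ∞ φ φ.source
  smooth_symm : ContDiffOn ℝ ∞ φ.symm φ.target

namespace IsSmoothChart

variable {φ : OpenPartialHomeomorph E F} {p : E}

theorem symm (hφ : IsSmoothChart φ) : IsSmoothChart φ.symm :=
  ⟨hφ.smooth_symm, by simpa using hφ.smooth⟩

theorem contDiffAt (hφ : IsSmoothChart φ) (hp : p ∈ φ.source) : ContDiffAt ℝ ∞ φ p :=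
  hφ.smooth.contDiffAt (φ.open_source.mem_nhds hp)

theorem differentiableAt (hφ : IsSmoothChart φ) (hp : p ∈ φ.source) : DifferentiableAt ℝ φ p :=
  (hφ.contDiffAt hp).differentiableAt (by simp)

theorem contDiffAt_of_comp (hφ : IsSmoothChart φ) {X : Type*} [NormedAddCommGroup X]
    [NormedSpace ℝ X] {γ : X → E} {x : X} {m : ℕ} (hγ : ∀ᶠ t in 𝓝 x, γ t ∈ φ.source)
    (h : ContDiffAt ℝ m (fun t => φ (γ t)) x) : ContDiffAt ℝ m γ x := by
  refine (((hφ.symm.contDiffAt (φ.map_source hγ.self_of_nhds)).of_le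
    (by exact_mod_cast le_top)).comp x h).congr_of_eventuallyEq ?_
  filter_upwards [hγ] with t ht
  exact (φ.left_inv ht).symm

theorem leftInverse_fderiv (hφ : IsSmoothChart φ) (hp : p ∈ φ.source) :
    Function.LeftInverse (fderiv ℝ φ.symm (φ p)) (fderiv ℝ φ p) :=
  leftInverse_fderiv_of_eventually (hφ.differentiableAt hp)
    (hφ.symm.differentiableAt (φ.map_source hp)) (φ.eventually_left_inverse hp)

end IsSmoothChart

theorem exists_isSmoothChart_of_hasFDerivAt_equiv [CompleteSpace E] {ψ : E → F} {S : Set E}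
    (hS : IsOpen S) (hψ : ContDiffOn ℝ ∞ ψ S) {z : E} (hz : z ∈ S) {e : E ≃L[ℝ] F}
    (he : HasFDerivAt ψ (e : E →L[ℝ] F) z) :
    ∃ φ : OpenPartialHomeomorph E F, IsSmoothChart φ ∧ ⇑φ = ψ ∧ z ∈ φ.source ∧ φ.source ⊆ S := by
  have hψAt : ∀ x ∈ S, ContDiffAt ℝ ∞ ψ x := fun x hx => hψ.contDiffAt (hS.mem_nhds hx)
  set W : Set E := S ∩ fderiv ℝ ψ ⁻¹' range ((↑) : (E ≃L[ℝ] F) → (E →L[ℝ] F))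
  have hW : IsOpen W := (hψ.continuousOn_fderiv_of_isOpen hS (by simp)).isOpen_inter_preimage hS
    ContinuousLinearEquiv.isOpen
  set φ := ((hψAt z hz).toOpenPartialHomeomorph ψ he (by simp)).restrOpen W hW
  have hsub : φ.source ⊆ W := inter_subset_right
  refine ⟨φ, ⟨hψ.mono (hsub.trans inter_subset_left), fun y hy => ?_⟩, rfl,
    ⟨(hψAt z hz).mem_toOpenPartialHomeomorph_source he (by simp), hz, e, he.fderiv.symm⟩,
    hsub.trans inter_subset_left⟩
  obtain ⟨hxS, e', he'⟩ := hsub (φ.map_target hy)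
  have hd : HasFDerivAt ψ (e' : E →L[ℝ] F) (φ.symm y) :=
    he' ▸ ((hψAt _ hxS).differentiableAt (by simp)).hasFDerivAt
  exact (φ.contDiffAt_symm hy hd (hψAt _ hxS)).contDiffWithinAt

end Charts

theorem IsRectifyingChart.isSmoothChart {M : Set (ℝ × ℝ)} {v : ℝ × ℝ → ℝ × ℝ}
    {φ : OpenPartialHomeomorph (ℝ × ℝ) (ℝ × ℝ)} (hφ : IsRectifyingChart M v φ) :
    IsSmoothChart φ :=
  ⟨hφ.smooth, hφ.smooth_symm⟩

/-! ### One real variable -/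

section OneVariable

variable {F : Type*} [NormedAddCommGroup F] [NormedSpace ℝ F] {I : Set ℝ}

theorem injOn_of_deriv_ne_zero {ρ : ℝ → ℝ} (hI : I.OrdConnected)
    (h : ∀ x ∈ I, deriv ρ x ≠ 0) : InjOn ρ I := by
  have ne_of_lt : ∀ a ∈ I, ∀ b ∈ I, a < b → ρ a ≠ ρ b := by
    intro a ha b hb hab hρ
    have hcont : ContinuousOn ρ (Icc a b) := fun x hx =>
      (differentiableAt_of_deriv_ne_zero (h x (hI.out ha hb hx))).continuousAt.continuousWithinAt
    obtain ⟨c, hc, hc0⟩ := exists_deriv_eq_zero hab hcont hρ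
    exact h c (hI.out ha hb (Ioo_subset_Icc_self hc)) hc0
  intro a ha b hb hρ
  rcases lt_trichotomy a b with hab | hab | hab
  · exact absurd hρ (ne_of_lt a ha b hb hab)
  · exact hab
  · exact absurd hρ.symm (ne_of_lt b hb a ha hab)

theorem eqOn_of_hasDerivAt_eq {f g d : ℝ → F} (hI : IsOpen I) (hI' : IsPreconnected I)
    (hf : ∀ t ∈ I, HasDerivAt f (d t) t) (hg : ∀ t ∈ I, HasDerivAt g (d t) t) {x : ℝ}
    (hx : x ∈ I) (h : f x = g x) : EqOn f g I :=
  hI.eqOn_of_deriv_eq hI' (fun t ht => (hf t ht).differentiableAt.differentiableWithinAt)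
    (fun t ht => (hg t ht).differentiableAt.differentiableWithinAt)
    (fun t ht => (hf t ht).deriv.trans (hg t ht).deriv.symm) hx h

theorem hasDerivAt_add_integral [CompleteSpace F] {θ : ℝ → F} (hI : IsOpen I)
    (hI' : IsPreconnected I) (hθ : ContinuousOn θ I) {a : ℝ} (ha : a ∈ I) (c : F) {r : ℝ}
    (hr : r ∈ I) : HasDerivAt (fun r => c + ∫ t in a..r, θ t) (θ r) r := by
  have hsub : uIcc a r ⊆ I := hI'.ordConnected.uIcc_subset ha hr
  exact (intervalIntegral.integral_hasDerivAt_right (hθ.mono hsub).intervalIntegrable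
    (hθ.stronglyMeasurableAtFilter hI r hr) (hθ.continuousAt (hI.mem_nhds hr))).const_add c

theorem add_integral_deriv_eq [CompleteSpace F] {g : ℝ → F} (hI : IsOpen I)
    (hI' : IsPreconnected I) (hg : ContDiffOn ℝ 1 g I) {a r : ℝ} (ha : a ∈ I) (hr : r ∈ I) :
    g a + ∫ t in a..r, deriv g t = g r := by
  have hsub : uIcc a r ⊆ I := hI'.ordConnected.uIcc_subset ha hr
  rw [intervalIntegral.integral_deriv_eq_sub
    (fun t ht => (hg.contDiffAt (hI.mem_nhds (hsub ht))).differentiableAt one_ne_zero)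
    ((hg.continuousOn_deriv_of_isOpen hI le_rfl).mono hsub).intervalIntegrable, add_sub_cancel]

theorem contDiffOn_succ_of_hasDerivAt {n : ℕ} {σ θ : ℝ → F} (hI : IsOpen I)
    (hθ : ContDiffOn ℝ n θ I) (hσ : ∀ r ∈ I, HasDerivAt σ (θ r) r) :
    ContDiffOn ℝ (n + 1 : ℕ) σ I := by
  rw [Nat.cast_succ, contDiffOn_succ_iff_deriv_of_isOpen hI]
  exact ⟨fun r hr => (hσ r hr).differentiableAt.differentiableWithinAt, by simp,
    hθ.congr fun r hr => (hσ r hr).deriv⟩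

end OneVariable

theorem eq_of_locally_eq {X Y : Type*} [TopologicalSpace X] [TopologicalSpace Y] [T1Space Y]
    {J : Set X} (hJ : IsPreconnected J) {h : X → Y} (hh : ContinuousOn h J) {y : Y}
    (hloc : ∀ t ∈ J, h t = y → ∀ᶠ t' in 𝓝[J] t, h t' = y) {a b : X} (ha : a ∈ J)
    (hb : b ∈ J) (hy : h a = y) : h b = y := by
  have : PreconnectedSpace J := isPreconnected_iff_preconnectedSpace.1 hJ
  have hclosed : IsClosed {t : J | h t = y} := isClosed_singleton.preimage hh.domRestrict
  have hopen : IsOpen {t : J | h t = y} := isOpen_iff_mem_nhds.2 fun t ht =>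
    (eventually_nhds_subtype_iff J t (fun t' => h t' = y)).2 (hloc t t.2 ht)
  have huniv := IsClopen.eq_univ ⟨hclosed, hopen⟩ ⟨⟨a, ha⟩, hy⟩
  exact huniv.ge (mem_univ ⟨b, hb⟩)

/-! ### Plane curves as graphs -/

/-- Near the parameter `x`, the curve `γ` runs along the graph of `g`. -/
def IsGraphGerm {F : Type*} (γ : ℝ → ℝ × F) (g : ℝ → F) (x : ℝ) : Prop :=
  ∀ᶠ t in 𝓝 x, g (γ t).1 = (γ t).2

theorem IsGraphGerm.eventuallyEq {F : Type*} {γ : ℝ → ℝ × F} {g : ℝ → F} {x : ℝ}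
    (h : IsGraphGerm γ g x) : (fun t => ((γ t).1, g (γ t).1)) =ᶠ[𝓝 x] γ :=
  h.mono fun _ ht => Prod.ext rfl ht

section GraphGerm

variable {F : Type*} [NormedAddCommGroup F] [NormedSpace ℝ F] {γ : ℝ → ℝ × F} {g : ℝ → F}
  {x : ℝ} {m : ℕ}

theorem map_nhds_eq_of_deriv_ne_zero {ρ : ℝ → ℝ} (hρ : ContDiffAt ℝ m ρ x) (hm : m ≠ 0)
    (h0 : deriv ρ x ≠ 0) : map ρ (𝓝 x) = 𝓝 (ρ x) :=
  (hρ.hasStrictDerivAt (by exact_mod_cast hm)).map_nhds_eq h0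

theorem exists_isGraphGerm (hγ : ContDiffAt ℝ m γ x) (hm : m ≠ 0)
    (h0 : deriv (fun t => (γ t).1) x ≠ 0) :
    ∃ g : ℝ → F, ContDiffAt ℝ m g (γ x).1 ∧ IsGraphGerm γ g x := by
  have hm' : (m : WithTop ℕ∞) ≠ 0 := by exact_mod_cast hm
  have hρ : ContDiffAt ℝ m (fun t => (γ t).1) x := hγ.fst
  have hd : HasFDerivAt (fun t => (γ t).1)
      (ContinuousLinearEquiv.unitsEquivAut ℝ (Units.mk0 _ h0) : ℝ →L[ℝ] ℝ) x := by
    have he : (ContinuousLinearEquiv.unitsEquivAut ℝ (Units.mk0 _ h0) : ℝ →L[ℝ] ℝ) =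
        ContinuousLinearMap.toSpanSingleton ℝ (deriv (fun t => (γ t).1) x) := by
      ext
      simp
    exact he ▸ (hρ.differentiableAt hm').hasDerivAt.hasFDerivAt
  set τ := hρ.localInverse hd hm'
  have hτx : τ (γ x).1 = x := hρ.localInverse_apply_image hd hm'
  refine ⟨fun r => (γ (τ r)).2,
    ContDiffAt.comp (g := fun t => (γ t).2) _ (hτx.symm ▸ hγ.snd) (hρ.to_localInverse hd hm'), ?_⟩
  filter_upwards [(hρ.hasStrictFDerivAt' hd hm').eventually_left_inverse] with t ht
  exact congrArg (fun t => (γ t).2) ht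

theorem IsGraphGerm.of_comp {G : Type*} {ψ : ℝ × F → ℝ × G} {h : ℝ → G} (hg : IsGraphGerm γ g x)
    (hh : IsGraphGerm (fun t => ψ (γ t)) h x) (hγ : ContDiffAt ℝ m γ x) (hm : m ≠ 0)
    (h0 : deriv (fun t => (γ t).1) x ≠ 0) : IsGraphGerm (fun r => ψ (r, g r)) h (γ x).1 := by
  rw [IsGraphGerm, ← map_nhds_eq_of_deriv_ne_zero hγ.fst hm h0, eventually_map]
  filter_upwards [hg.eventuallyEq, hh] with t hγt ht
  rwa [hγt]

theorem IsGraphGerm.eventuallyEq_of_isGraphGerm {g' : ℝ → F} (hg : IsGraphGerm γ g x)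
    (hg' : IsGraphGerm γ g' x) (hγ : ContDiffAt ℝ m γ x) (hm : m ≠ 0)
    (h0 : deriv (fun t => (γ t).1) x ≠ 0) : g' =ᶠ[𝓝 (γ x).1] g :=
  hg.of_comp (ψ := id) hg' hγ hm h0

theorem IsGraphGerm.deriv_fst_comp {G : Type*} [NormedAddCommGroup G] [NormedSpace ℝ G]
    {ψ : ℝ × F → ℝ × G} (hg : IsGraphGerm γ g x)
    (hψ : DifferentiableAt ℝ ψ (γ x)) (hgd : DifferentiableAt ℝ g (γ x).1)
    (hγ : DifferentiableAt ℝ γ x) :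
    deriv (fun t => (ψ (γ t)).1) x =
      deriv (fun r => (ψ (r, g r)).1) (γ x).1 * deriv (fun t => (γ t).1) x := by
  have hψ' : DifferentiableAt ℝ ψ ((γ x).1, g (γ x).1) := by rwa [hg.eventuallyEq.eq_of_nhds]
  have houter : DifferentiableAt ℝ (fun r => (ψ (r, g r)).1) (γ x).1 :=
    (hψ'.comp (γ x).1 (differentiableAt_id.prodMk hgd)).fst
  rw [← deriv_comp x houter hγ.fst]
  refine EventuallyEq.deriv_eq ?_
  filter_upwards [hg.eventuallyEq] with t ht
  simp only [Function.comp_apply, ht]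

theorem exists_contDiffOn_graph {I : Set ℝ} (hI : IsOpen I) (hI' : IsConnected I)
    (hγ : ∀ x ∈ I, ContDiffAt ℝ m γ x) (hm : m ≠ 0)
    (h0 : ∀ x ∈ I, deriv (fun t => (γ t).1) x ≠ 0) :
    InjOn (fun t => (γ t).1) I ∧ IsOpen ((fun t => (γ t).1) '' I) ∧
      IsConnected ((fun t => (γ t).1) '' I) ∧
      ∃ g : ℝ → F, ContDiffOn ℝ m g ((fun t => (γ t).1) '' I) ∧ ∀ x ∈ I, IsGraphGerm γ g x := by
  have hinj : InjOn (fun t => (γ t).1) I :=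
    injOn_of_deriv_ne_zero hI'.isPreconnected.ordConnected h0
  have hcont : ContinuousOn (fun t => (γ t).1) I := fun x hx =>
    (hγ x hx).fst.continuousAt.continuousWithinAt
  set g : ℝ → F := fun r => (γ (Function.invFunOn (fun t => (γ t).1) I r)).2
  have hg : ∀ x ∈ I, IsGraphGerm γ g x := fun x hx => by
    filter_upwards [hI.mem_nhds hx] with t ht
    exact congrArg (fun t => (γ t).2) (hinj.leftInvOn_invFunOn ht)
  refine ⟨hinj, isOpen_iff_mem_nhds.2 ?_, hI'.image _ hcont, g, ?_, hg⟩
  · rintro _ ⟨x, hx, rfl⟩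
    rw [← map_nhds_eq_of_deriv_ne_zero (hγ x hx).fst hm (h0 x hx)]
    exact image_mem_map (hI.mem_nhds hx)
  · rintro _ ⟨x, hx, rfl⟩
    obtain ⟨g', hg', hgerm⟩ := exists_isGraphGerm (hγ x hx) hm (h0 x hx)
    exact (hg'.congr_of_eventuallyEq
      (hgerm.eventuallyEq_of_isGraphGerm (hg x hx) (hγ x hx) hm (h0 x hx))).contDiffWithinAt

end GraphGerm

/-! ### Jets of functions -/

section Jets

variable {k m n : ℕ} {f g : ℝ → ℝ} {x : ℝ}

theorem base_jet (k : ℕ) (f : ℝ → ℝ) (x : ℝ) : (jet k f x).base = (x, f x) := by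
  simp [jet, Jet.base]

theorem jet_congr (h : f =ᶠ[𝓝 x] g) (k : ℕ) : jet k f x = jet k g x :=
  Prod.ext rfl (funext fun i => h.iteratedDeriv_eq i)

theorem iteratedDeriv_sum_pow_taylor (a : Fin (k + 1) → ℝ) (x : ℝ) (j : Fin (k + 1)) :
    iteratedDeriv j
      (fun t => ∑ i : Fin (k + 1), (a i / (i : ℕ).factorial) * (t - x) ^ (i : ℕ)) x = a j := by
  have hmonomial : ∀ i : Fin (k + 1), iteratedDeriv j
      (fun t : ℝ => (a i / (i : ℕ).factorial) * (t - x) ^ (i : ℕ)) x =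
        if i = j then a j else 0 := by
    intro i
    rw [iteratedDeriv_const_mul_field, iteratedDeriv_comp_sub_const (f := fun t : ℝ => t ^ (i : ℕ))]
    simp only [sub_self]
    rw [iteratedDeriv_fun_pow_zero]
    by_cases hij : i = j
    · subst hij
      simp [Nat.factorial_ne_zero]
    · rw [if_neg fun h => hij (Fin.ext h.symm), if_neg hij, Nat.cast_zero, mul_zero]
  rw [iteratedDeriv_fun_sum fun i _ => by fun_prop]
  simp [hmonomial]

theorem exists_contDiff_jet_eq (q : Jet k) :
    ∃ f : ℝ → ℝ, ContDiff ℝ ∞ f ∧ jet k f q.1 = q :=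
  ⟨fun t => ∑ i : Fin (k + 1), (q.2 i / (i : ℕ).factorial) * (t - q.1) ^ (i : ℕ), by fun_prop,
    Prod.ext rfl (funext (iteratedDeriv_sum_pow_taylor q.2 q.1))⟩

theorem differentiableAt_iteratedDeriv {i : ℕ} (hf : ContDiffAt ℝ k f x) (hi : i < k) :
    DifferentiableAt ℝ (iteratedDeriv i f) x := by
  have h := (hf.contDiffWithinAt (s := univ)).differentiableWithinAt_iteratedDerivWithin
    (m := i) (by exact_mod_cast hi) (by simp)
  simpa only [iteratedDerivWithin_univ, differentiableWithinAt_univ] using h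

theorem hasDerivAt_jet (hf : ContDiffAt ℝ (k + 1 : ℕ) f x) :
    HasDerivAt (jet k f) (1, fun i : Fin (k + 1) => (jet (k + 1) f x).2 i.succ) x := by
  refine (hasDerivAt_id x).prodMk (hasDerivAt_pi.2 fun i => ?_)
  have h := (differentiableAt_iteratedDeriv hf i.2).hasDerivAt
  rwa [← iteratedDeriv_succ] at h

theorem hasDerivAt_comp_jet (hf : ContDiffAt ℝ (k + 1 : ℕ) f x) {H : Jet k → ℝ}
    (hH : DifferentiableAt ℝ H (jet k f x)) :
    HasDerivAt (fun t => H (jet k f t)) (totalDeriv H (jet (k + 1) f x)) x :=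
  hH.hasFDerivAt.comp_hasDerivAt x (hasDerivAt_jet hf)

theorem continuousAt_iteratedDeriv {i : ℕ} (hf : ContDiffAt ℝ k f x) (hi : i ≤ k) :
    ContinuousAt (iteratedDeriv i f) x := by
  rcases hi.lt_or_eq with hi | rfl
  · exact (differentiableAt_iteratedDeriv hf hi).continuousAt
  · obtain ⟨u, hu, hfu⟩ := hf.contDiffOn le_rfl (by simp)
    obtain ⟨v, hvu, hv, hxv⟩ := mem_nhds_iff.1 (by simpa using hu)
    refine (((hfu.mono hvu).continuousOn_iteratedDerivWithin le_rfl hv.uniqueDiffOn).congr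
      fun y hy => ?_).continuousAt (hv.mem_nhds hxv)
    exact (iteratedDerivWithin_of_isOpen hv hy).symm

theorem continuousAt_jet (hf : ContDiffAt ℝ k f x) : ContinuousAt (jet k f) x :=
  continuousAt_id.prodMk (continuousAt_pi.2 fun i =>
    continuousAt_iteratedDeriv hf (Nat.le_of_lt_succ i.2))

@[fun_prop]
theorem contDiff_restrict (h : k + 1 ≤ m + 1) :
    ContDiff ℝ ∞ (fun q : Jet m => q.restrict h) := by
  unfold Jet.restrict
  fun_prop

@[fun_prop]
theorem contDiff_base : ContDiff ℝ ∞ (fun q : Jet k => q.base) := by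
  unfold Jet.base
  fun_prop

/-- The jet `(r, (s, z, z₁, …, z_n))` assembled from `s` and `(r, (z, z₁, …, z_n))`. -/
def Jet.cons (s : ℝ) (w : Jet n) : Jet (n + 1) := (w.1, Fin.cons s w.2)

theorem Jet.cons_inj {s s' : ℝ} {w w' : Jet n} :
    Jet.cons s w = Jet.cons s' w' ↔ s = s' ∧ w = w' := by
  simp only [Jet.cons, Prod.ext_iff, Fin.cons_inj]
  tauto

@[fun_prop]
theorem Jet.contDiff_cons : ContDiff ℝ ∞ (fun z : ℝ × Jet n => Jet.cons z.1 z.2) := by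
  refine contDiff_snd.fst.prodMk (contDiff_pi.2 (Fin.cases ?_ fun j => ?_))
  · simpa using contDiff_fst
  · simp only [Fin.cons_succ]
    fun_prop

theorem jet_succ_eq_cons (n : ℕ) (g : ℝ → ℝ) (r : ℝ) :
    jet (n + 1) g r = Jet.cons (g r) (jet n (deriv g) r) :=
  Prod.ext rfl <| funext <| Fin.cases (by simp [jet, Jet.cons]) fun j => by
    simp [jet, Jet.cons, iteratedDeriv_succ']

theorem jet_succ_eq_cons_of_hasDerivAt {σ θ : ℝ → ℝ} {I : Set ℝ} (hI : IsOpen I)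
    (hσ : ∀ t ∈ I, HasDerivAt σ (θ t) t) (n : ℕ) (hx : x ∈ I) :
    jet (n + 1) σ x = Jet.cons (σ x) (jet n θ x) := by
  rw [jet_succ_eq_cons, jet_congr (eventually_of_mem (hI.mem_nhds hx) fun t ht => (hσ t ht).deriv)]

end Jets

/-! ### Prolongation to jets -/

/-- The total derivative `D_x r` of the first component of `φ = (r, s)`, on jets of any positive
order. -/
noncomputable def totalDerivFst {k : ℕ} (φ : ℝ × ℝ → ℝ × ℝ) (q : Jet (k + 1)) : ℝ :=
  totalDeriv (fun p : Jet 0 => (φ p.base).1) (q.restrict (by omega) : Jet 1)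

/-- The prolongation of `φ = (r, s)` to jets: `(r, (s, ds/dr, …, d^k s/dr^k))`. -/
noncomputable def prolong {k : ℕ} (φ : ℝ × ℝ → ℝ × ℝ) (q : Jet k) : Jet k :=
  ((φ q.base).1, fun i => sDeriv φ i (q.restrict (Nat.succ_le_of_lt i.2)))

section Prolongation

variable {φ : ℝ × ℝ → ℝ × ℝ} {k : ℕ} {f g : ℝ → ℝ} {x : ℝ}

theorem prolong_eq_cons (φ : ℝ × ℝ → ℝ × ℝ) (q : Jet (k + 1)) :
    prolong φ q = Jet.cons (φ q.base).2 (reducedJet φ q) :=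
  Prod.ext rfl (funext (Fin.cases rfl fun _ => rfl))

theorem contDiffAt_totalDeriv {H : Jet k → ℝ} {q : Jet (k + 1)}
    (hH : ContDiffAt ℝ ∞ H (q.restrict (Nat.le_succ _))) : ContDiffAt ℝ ∞ (totalDeriv H) q := by
  have h : ContDiffAt ℝ ∞ (fderiv ℝ H) (q.restrict (Nat.le_succ _)) := hH.fderiv_right (by simp)
  exact (ContDiffAt.comp q h (contDiff_restrict _).contDiffAt).clm_apply (by fun_prop)

theorem contDiffAt_totalDerivFst {q : Jet (k + 1)} (hφ : ContDiffAt ℝ ∞ φ q.base) :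
    ContDiffAt ℝ ∞ (totalDerivFst φ) q := by
  have hr : ContDiffAt ℝ ∞ (fun p : Jet 0 => (φ p.base).1) (q.restrict (by omega)) :=
    (ContDiffAt.comp (q.restrict (by omega) : Jet 0) hφ contDiff_base.contDiffAt).fst
  exact ContDiffAt.comp q (contDiffAt_totalDeriv (q := q.restrict (by omega)) hr)
    (contDiff_restrict _).contDiffAt

theorem totalDerivFst_jet (hφ : DifferentiableAt ℝ φ (x, f x)) (hf : ContDiffAt ℝ 1 f x) :
    totalDerivFst φ (jet (k + 1) f x) = deriv (fun t => (φ (t, f t)).1) x := by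
  have hr : DifferentiableAt ℝ (fun p : Jet 0 => (φ p.base).1) (jet 0 f x) :=
    (DifferentiableAt.comp (g := φ) _ (by rwa [base_jet])
      (contDiff_base.differentiable (by simp)).differentiableAt).fst
  have h := (hasDerivAt_comp_jet (k := 0) (by simpa using hf) hr).deriv
  simp only [base_jet] at h
  exact h.symm

theorem totalDerivFst_eq {q : Jet (k + 1)} (hφ : DifferentiableAt ℝ φ q.base) :
    totalDerivFst φ q = (fderiv ℝ φ q.base (1, q.2 1)).1 := by
  obtain ⟨f, hf, hfq⟩ := exists_contDiff_jet_eq q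
  generalize q.1 = x at hfq
  subst hfq
  rw [base_jet] at hφ ⊢
  rw [totalDerivFst_jet hφ (hf.of_le (by exact_mod_cast le_top)).contDiffAt]
  have hdf : HasDerivAt f (deriv f x) x := (hf.differentiable (by simp) x).hasDerivAt
  have hgraph := hφ.hasFDerivAt.comp_hasDerivAt x ((hasDerivAt_id' x).prodMk hdf)
  simpa [jet] using hgraph.hasFDerivAt.fst.hasDerivAt.deriv

theorem contDiffAt_sDeriv {q : Jet (k + 1)} (hφ : ContDiffAt ℝ ∞ φ q.base)
    (h0 : totalDerivFst φ q ≠ 0) {i : ℕ} (hi : i + 1 ≤ k + 1 + 1) :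
    ContDiffAt ℝ ∞ (sDeriv φ i) (q.restrict hi) := by
  induction i with
  | zero => exact (ContDiffAt.comp (q.restrict hi) hφ contDiff_base.contDiffAt).snd
  | succ i ih =>
    exact (contDiffAt_totalDeriv (q := q.restrict hi) (ih (by omega))).div
      (contDiffAt_totalDerivFst (q := q.restrict hi) hφ) h0

theorem contDiffAt_prolong {q : Jet (k + 1)} (hφ : ContDiffAt ℝ ∞ φ q.base)
    (h0 : totalDerivFst φ q ≠ 0) : ContDiffAt ℝ ∞ (prolong φ : Jet (k + 1) → Jet (k + 1)) q :=
  (ContDiffAt.comp q hφ contDiff_base.contDiffAt).fst.prodMk <| contDiffAt_pi.2 fun i =>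
    ContDiffAt.comp (g := sDeriv φ i) q (contDiffAt_sDeriv hφ h0 (Nat.succ_le_of_lt i.2))
      (contDiff_restrict _).contDiffAt

theorem IsGraphGerm.eventually_sDeriv_jet (hg : IsGraphGerm (fun t => φ (t, f t)) g x)
    (hφ : ContDiffAt ℝ ∞ φ (x, f x)) (hf : ContDiffAt ℝ (k + 1 : ℕ) f x)
    (hgc : ContDiffAt ℝ (k + 1 : ℕ) g (φ (x, f x)).1)
    (h0 : totalDerivFst φ (jet (k + 1) f x) ≠ 0) {i : ℕ} (hi : i ≤ k + 1) :
    ∀ᶠ t in 𝓝 x, sDeriv φ i (jet i f t) = iteratedDeriv i g (φ (t, f t)).1 := by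
  induction i with
  | zero =>
    filter_upwards [hg] with t ht
    simpa [sDeriv, base_jet] using ht.symm
  | succ i ih =>
    have hφ' : ContDiffAt ℝ ∞ φ (jet (k + 1) f x).base := by rwa [base_jet]
    have hgraph : ContinuousAt (fun t => (t, f t)) x := continuousAt_id.prodMk hf.continuousAt
    have hρ : ContinuousAt (fun t => (φ (t, f t)).1) x :=
      (hφ.continuousAt.comp_of_eq hgraph rfl).fst
    filter_upwards [(ih (by omega)).eventually_nhds, hf.eventually (by simp),
      hρ.eventually (hgc.eventually (by simp)),
      hgraph.eventually ((hφ.of_le (m := 1) (by simp)).eventually (by simp)),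
      (continuousAt_jet (hf.of_le (by exact_mod_cast (Nat.le_of_lt hi)))).eventually
        (((contDiffAt_sDeriv hφ' h0 (i := i) (by omega)).of_le (m := 1) (by simp)).eventually
          (by simp)),
      (continuousAt_jet hf).eventually
        ((contDiffAt_totalDerivFst hφ').continuousAt.eventually_ne h0)]
      with t hih hft hgt hφt hst h0t
    have hf1 : ContDiffAt ℝ 1 f t := hft.of_le (by exact_mod_cast Nat.le_add_left 1 k)
    have hφd := hφt.differentiableAt one_ne_zero
    have hleft := hasDerivAt_comp_jet (hft.of_le (by exact_mod_cast hi))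
      (hst.differentiableAt one_ne_zero)
    have hrd : DifferentiableAt ℝ (fun t => (φ (t, f t)).1) t :=
      (hφd.comp t (differentiableAt_id.prodMk (hf1.differentiableAt one_ne_zero))).fst
    have hright := (differentiableAt_iteratedDeriv hgt (by omega : i < k + 1)).hasDerivAt.comp t
      hrd.hasDerivAt
    rw [← iteratedDeriv_succ, ← totalDerivFst_jet (k := k) hφd hf1] at hright
    exact (div_eq_iff h0t).2 (hleft.unique (hright.congr_of_eventuallyEq hih))

theorem IsGraphGerm.prolong_jet (hg : IsGraphGerm (fun t => φ (t, f t)) g x)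
    (hφ : ContDiffAt ℝ ∞ φ (x, f x)) (hf : ContDiffAt ℝ (k + 1 : ℕ) f x)
    (hgc : ContDiffAt ℝ (k + 1 : ℕ) g (φ (x, f x)).1)
    (h0 : totalDerivFst φ (jet (k + 1) f x) ≠ 0) :
    prolong φ (jet (k + 1) f x) = jet (k + 1) g (φ (x, f x)).1 :=
  Prod.ext (by rw [prolong, base_jet]; rfl) <| funext fun i =>
    (hg.eventually_sDeriv_jet hφ hf hgc h0 (Nat.le_of_lt_succ i.2)).self_of_nhds

theorem IsGraphGerm.reducedJet_jet (hg : IsGraphGerm (fun t => φ (t, f t)) g x)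
    (hφ : ContDiffAt ℝ ∞ φ (x, f x)) (hf : ContDiffAt ℝ (k + 1 : ℕ) f x)
    (hgc : ContDiffAt ℝ (k + 1 : ℕ) g (φ (x, f x)).1)
    (h0 : totalDerivFst φ (jet (k + 1) f x) ≠ 0) :
    reducedJet φ (jet (k + 1) f x) = jet k (deriv g) (φ (x, f x)).1 := by
  have h := hg.prolong_jet hφ hf hgc h0
  rw [prolong_eq_cons, jet_succ_eq_cons k g] at h
  exact (Jet.cons_inj.1 h).2

end Prolongation

/-- The jets over the source of `φ = (r, s)` along which `D_x r` does not vanish. -/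
def regularJets (φ : OpenPartialHomeomorph (ℝ × ℝ) (ℝ × ℝ)) (k : ℕ) : Set (Jet (k + 1)) :=
  {q | q.base ∈ φ.source ∧ totalDerivFst φ q ≠ 0}

/-- The direction `∂/∂y_k` of the highest derivative in `J^k`. -/
def topDirection (k : ℕ) : Jet k := (0, Pi.single (Fin.last k) 1)

theorem topDirection_ne_zero (k : ℕ) : topDirection k ≠ 0 := fun h => by
  simpa [topDirection] using congrFun (congrArg Prod.snd h) (Fin.last k)

theorem Jet.cons_add_smul_topDirection {n : ℕ} (s t : ℝ) (w : Jet n) :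
    Jet.cons s (w + t • topDirection n) = Jet.cons s w + t • topDirection (n + 1) := by
  refine Prod.ext (by simp [Jet.cons, topDirection]) (funext (Fin.cases ?_ fun j => ?_))
  · simp [Jet.cons, topDirection]
  · rcases eq_or_ne j (Fin.last n) with rfl | hj
    · simp [Jet.cons, topDirection, ← Fin.succ_last]
    · simp [Jet.cons, topDirection, ← Fin.succ_last, hj]

theorem Jet.restrict_add_smul_topDirection {m k : ℕ} (h : k + 1 ≤ m + 1) (hk : k < m) (q : Jet m)
    (t : ℝ) : (q + t • topDirection m).restrict h = q.restrict h := by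
  refine Prod.ext (by simp [Jet.restrict, topDirection]) (funext fun i => ?_)
  have hi : Fin.castLE h i ≠ Fin.last m := Fin.ne_of_val_ne (by simp; omega)
  simp [Jet.restrict, topDirection, hi]

theorem prolong_add_smul_topDirection_sub (φ : ℝ × ℝ → ℝ × ℝ) {k : ℕ} (q : Jet (k + 1)) (t : ℝ) :
    prolong φ (q + t • topDirection (k + 1)) - prolong φ q ∈
      Submodule.span ℝ {topDirection (k + 1)} := by
  set q' := q + t • topDirection (k + 1)
  have hrestrict : ∀ {i : ℕ} (hi : i + 1 ≤ k + 1 + 1), i < k + 1 → q'.restrict hi = q.restrict hi :=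
    fun hi hik => q.restrict_add_smul_topDirection hi hik t
  have hbase : q'.base = q.base :=
    congrArg (Jet.base (k := 0)) (hrestrict (by omega) (by omega))
  refine Submodule.mem_span_singleton.2 ⟨(prolong φ q' - prolong φ q).2 (Fin.last (k + 1)),
    Prod.ext (by simp [prolong, topDirection, hbase]) (funext (Fin.lastCases ?_ fun j => ?_))⟩
  · simp [topDirection]
  · have h : (prolong φ q').2 j.castSucc = (prolong φ q).2 j.castSucc :=
      congrArg (sDeriv φ j) (hrestrict _ j.2)
    simp [topDirection, h, Fin.castSucc_ne_last]

namespace IsSmoothChart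

variable {φ : OpenPartialHomeomorph (ℝ × ℝ) (ℝ × ℝ)} {k m : ℕ} {q : Jet (k + 1)} {f g : ℝ → ℝ}
  {x : ℝ}

theorem isOpen_regularJets (hφ : IsSmoothChart φ) (k : ℕ) : IsOpen (regularJets φ k) :=
  isOpen_iff_mem_nhds.2 fun _ hq =>
    (contDiff_base.continuous.continuousAt.eventually (φ.open_source.mem_nhds hq.1)).and
      ((contDiffAt_totalDerivFst (hφ.contDiffAt hq.1)).continuousAt.eventually_ne hq.2)

theorem contDiffAt_comp_graph (hφ : IsSmoothChart φ) (hp : (x, f x) ∈ φ.source)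
    (hf : ContDiffAt ℝ m f x) : ContDiffAt ℝ m (fun t => φ (t, f t)) x :=
  ContDiffAt.comp x ((hφ.contDiffAt hp).of_le (by exact_mod_cast le_top))
    (contDiffAt_id.prodMk hf)

theorem jet_mem_regularJets_iff (hφ : IsSmoothChart φ) (hf : ContDiffAt ℝ (k + 1 : ℕ) f x) :
    jet (k + 1) f x ∈ regularJets φ k ↔
      (x, f x) ∈ φ.source ∧ deriv (fun t => (φ (t, f t)).1) x ≠ 0 := by
  rw [regularJets, mem_ofPred_eq, base_jet]
  refine and_congr_right fun hp => ?_
  rw [totalDerivFst_jet (hφ.differentiableAt hp) (hf.of_le (by simp))]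

theorem isGraphGerm_symm (hφ : IsSmoothChart φ)
    (hp : (x, f x) ∈ φ.source) (hf : ContDiffAt ℝ m f x) (hm : m ≠ 0)
    (h0 : deriv (fun t => (φ (t, f t)).1) x ≠ 0) (hgd : DifferentiableAt ℝ g (φ (x, f x)).1)
    (hg : IsGraphGerm (fun t => φ (t, f t)) g x) :
    IsGraphGerm (fun r => φ.symm (r, g r)) f (φ (x, f x)).1 ∧
      deriv (fun r => (φ.symm (r, g r)).1) (φ (x, f x)).1 ≠ 0 := by
  have hγ := hφ.contDiffAt_comp_graph hp hf
  have hinv : ∀ᶠ t in 𝓝 x, φ.symm (φ (t, f t)) = (t, f t) :=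
    (continuousAt_id.prodMk hf.continuousAt).eventually (φ.eventually_left_inverse hp)
  refine ⟨hg.of_comp (hinv.mono fun t ht => ?_) hγ hm h0, left_ne_zero_of_mul
    (b := deriv (fun t => (φ (t, f t)).1) x) ?_⟩
  · simp only [ht]
  · rw [← hg.deriv_fst_comp (hφ.symm.differentiableAt (φ.map_source hp)) hgd
      (hγ.differentiableAt (by exact_mod_cast hm)),
      EventuallyEq.deriv_eq (hinv.mono fun t ht => congrArg Prod.fst ht), deriv_id'']
    exact one_ne_zero

theorem prolong_symm_prolong (hφ : IsSmoothChart φ) (hq : q ∈ regularJets φ k) :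
    prolong φ q ∈ regularJets φ.symm k ∧ prolong φ.symm (prolong φ q) = q := by
  obtain ⟨f, hf, hfq⟩ := exists_contDiff_jet_eq q
  generalize q.1 = x at hfq
  subst hfq
  have hfc : ContDiffAt ℝ (k + 1 : ℕ) f x := (hf.of_le (by exact_mod_cast le_top)).contDiffAt
  obtain ⟨hp, hd⟩ := (hφ.jet_mem_regularJets_iff hfc).1 hq
  obtain ⟨g, hgc, hg⟩ := exists_isGraphGerm (hφ.contDiffAt_comp_graph hp hfc) k.succ_ne_zero hd
  obtain ⟨hg', hd'⟩ := hφ.isGraphGerm_symm hp hfc k.succ_ne_zero hd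
    (hgc.differentiableAt (by simp)) hg
  have hpt : ((φ (x, f x)).1, g (φ (x, f x)).1) = φ (x, f x) := hg.eventuallyEq.eq_of_nhds
  have htarget : ((φ (x, f x)).1, g (φ (x, f x)).1) ∈ φ.target := hpt ▸ φ.map_source hp
  have hsymm : φ.symm ((φ (x, f x)).1, g (φ (x, f x)).1) = (x, f x) := hpt ▸ φ.left_inv hp
  have hmem : jet (k + 1) g (φ (x, f x)).1 ∈ regularJets φ.symm k :=
    (hφ.symm.jet_mem_regularJets_iff hgc).2 ⟨htarget, hd'⟩
  rw [hg.prolong_jet (hφ.contDiffAt hp) hfc hgc hq.2]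
  refine ⟨hmem, ?_⟩
  rw [hg'.prolong_jet (hφ.symm.contDiffAt htarget) hgc (by rwa [hsymm]) hmem.2, hsymm]

theorem prolong_prolong_symm (hφ : IsSmoothChart φ) (hq : q ∈ regularJets φ.symm k) :
    prolong φ.symm q ∈ regularJets φ k ∧ prolong φ (prolong φ.symm q) = q := by
  simpa using hφ.symm.prolong_symm_prolong hq

theorem fderiv_prolong_topDirection (hφ : IsSmoothChart φ) (hq : q ∈ regularJets φ k) :
    ∃ κ : ℝ, κ ≠ 0 ∧
      fderiv ℝ (prolong φ) q (topDirection (k + 1)) = κ • topDirection (k + 1) := by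
  have hd := (contDiffAt_prolong (hφ.contDiffAt hq.1) hq.2).differentiableAt (by simp)
  obtain ⟨hq', -⟩ := hφ.prolong_symm_prolong hq
  have hd' := (contDiffAt_prolong (hφ.symm.contDiffAt hq'.1) hq'.2).differentiableAt (by simp)
  have hleft := leftInverse_fderiv_of_eventually hd hd' <|
    mem_of_superset ((hφ.isOpen_regularJets k).mem_nhds hq) fun p hp =>
      (hφ.prolong_symm_prolong hp).2
  have hspan : fderiv ℝ (prolong φ) q (topDirection (k + 1)) ∈
      Submodule.span ℝ {topDirection (k + 1)} :=
    (Submodule.closed_of_finiteDimensional _).mem_of_tendsto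
      (hd.hasFDerivAt.hasLineDerivAt _).tendsto_slope_zero <| Eventually.of_forall fun t =>
        Submodule.smul_mem _ _ (prolong_add_smul_topDirection_sub φ q t)
  obtain ⟨κ, hκ⟩ := Submodule.mem_span_singleton.1 hspan
  refine ⟨κ, ?_, hκ.symm⟩
  rintro rfl
  refine topDirection_ne_zero (k + 1) ?_
  rw [← hleft (topDirection (k + 1)), ← hκ, zero_smul, map_zero]

end IsSmoothChart

/-! ### Solutions with prescribed jet -/

section ExistsSolution

variable {k : ℕ} {I : Set ℝ} {Ω : Set (Jet k)} {E : Jet k → ℝ} {q : Jet k} {f : ℝ → ℝ}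

theorem IsODE.contDiffAt (hE : IsODE k Ω E) (hq : q ∈ Ω) : ContDiffAt ℝ ∞ E q :=
  hE.smooth.contDiffAt (hE.isOpen.mem_nhds hq)

theorem IsSolution.contDiffAt (hf : IsSolution k Ω E I f) {x : ℝ} (hx : x ∈ I) :
    ContDiffAt ℝ k f x :=
  hf.contDiffOn.contDiffAt (hf.isOpen.mem_nhds hx)

theorem IsSolution.mono (hf : IsSolution k Ω E I f) {I' : Set ℝ} (hI'I : I' ⊆ I)
    (hI' : IsOpen I') (hI'c : IsConnected I') : IsSolution k Ω E I' f :=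
  ⟨hI', hI'c, hf.contDiffOn.mono hI'I, fun x hx => hf.mem x (hI'I hx),
    fun x hx => hf.eq_zero x (hI'I hx)⟩

theorem exists_integralCurve_mem {V : Type*} [NormedAddCommGroup V] [NormedSpace ℝ V]
    [CompleteSpace V] {X : V → V} {q : V} (hX : ContDiffAt ℝ 1 X q) {W : Set V} (hW : W ∈ 𝓝 q)
    (t₀ : ℝ) : ∃ α : ℝ → V, α t₀ = q ∧
      ∃ δ > 0, ∀ t ∈ Metric.ball t₀ δ, HasDerivAt α (X (α t)) t ∧ α t ∈ W := by
  obtain ⟨α, hα₀, ε, hε, hα⟩ :=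
    hX.exists_forall_mem_closedBall_exists_eq_forall_mem_Ioo_hasDerivAt₀ t₀
  have ht₀ : t₀ ∈ Ioo (t₀ - ε) (t₀ + ε) := ⟨sub_lt_self _ hε, lt_add_of_pos_right _ hε⟩
  have hαW : ∀ᶠ t in 𝓝 t₀, α t ∈ W := (hα t₀ ht₀).continuousAt.eventually (by rwa [hα₀])
  obtain ⟨δ, hδ, hball⟩ := Metric.eventually_nhds_iff_ball.1
    ((isOpen_Ioo.eventually_mem ht₀).and hαW)
  exact ⟨α, hα₀, δ, hδ, fun t ht => ⟨hα t (hball t ht).1, (hball t ht).2⟩⟩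

theorem contDiffOn_of_hasDerivAt_succ (hI : IsOpen I) {y : Fin (k + 1) → ℝ → ℝ}
    (hy : ∀ (i : Fin k), ∀ t ∈ I, HasDerivAt (y i.castSucc) (y i.succ t) t)
    (hc : ContinuousOn (y (Fin.last k)) I) : ContDiffOn ℝ k (y 0) I := by
  induction k with
  | zero => simpa using hc
  | succ k ih =>
    exact contDiffOn_succ_of_hasDerivAt hI
      (ih (y := fun i => y i.succ) (fun i => hy i.succ) hc) (hy 0)

theorem iteratedDeriv_of_hasDerivAt_succ (hI : IsOpen I) {y : Fin (k + 1) → ℝ → ℝ}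
    (hy : ∀ (i : Fin k), ∀ t ∈ I, HasDerivAt (y i.castSucc) (y i.succ t) t) (i : Fin (k + 1)) :
    ∀ t ∈ I, iteratedDeriv i (y 0) t = y i t := by
  induction i using Fin.induction with
  | zero => simp
  | succ i ih =>
    intro t ht
    rw [Fin.val_succ, iteratedDeriv_succ]
    exact ((hy i t ht).congr_of_eventuallyEq (eventually_of_mem (hI.mem_nhds ht) ih)).deriv

/-- The part of the total derivative on `J^k` that does not involve `y_{k+1}`:
`∂_x + y₁ ∂_y + … + y_k ∂_{y_{k-1}}`. -/
def truncatedField (q : Jet k) : Jet k :=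
  (1, Fin.snoc (α := fun _ => ℝ) (fun i : Fin k => q.2 i.succ) 0)

/-- The vector field on `J^k` whose integral curves in `E = 0` are the jets of the solutions. The
multiple of `∂/∂y_k` is chosen to make it tangent to the level sets of `E`. -/
noncomputable def solutionField (E : Jet k → ℝ) (q : Jet k) : Jet k :=
  truncatedField q -
    (fderiv ℝ E q (truncatedField q) / fderiv ℝ E q (topDirection k)) • topDirection k

theorem contDiff_truncatedField : ContDiff ℝ ∞ (truncatedField : Jet k → Jet k) := by
  refine contDiff_const.prodMk (contDiff_pi.2 (Fin.lastCases ?_ fun j => ?_))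
  · simpa using contDiff_const
  · simp only [Fin.snoc_castSucc]
    fun_prop

theorem contDiffAt_solutionField (hE : ContDiffAt ℝ ∞ E q)
    (h : fderiv ℝ E q (topDirection k) ≠ 0) : ContDiffAt ℝ ∞ (solutionField E) q := by
  have hdE : ContDiffAt ℝ ∞ (fderiv ℝ E) q := hE.fderiv_right (by simp)
  have hT := (contDiff_truncatedField (k := k)).contDiffAt (x := q)
  exact hT.sub (((hdE.clm_apply hT).div (hdE.clm_apply contDiffAt_const) h).smul contDiffAt_const)

theorem fderiv_solutionField (h : fderiv ℝ E q (topDirection k) ≠ 0) :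
    fderiv ℝ E q (solutionField E q) = 0 := by
  rw [solutionField, map_sub, map_smul, smul_eq_mul, div_mul_cancel₀ _ h, sub_self]

theorem solutionField_fst (E : Jet k → ℝ) (q : Jet k) : (solutionField E q).1 = 1 := by
  simp [solutionField, truncatedField, topDirection]

theorem solutionField_snd_castSucc (E : Jet k → ℝ) (q : Jet k) (i : Fin k) :
    (solutionField E q).2 i.castSucc = q.2 i.succ := by
  simp [solutionField, truncatedField, topDirection, Fin.castSucc_ne_last]

theorem jet_eq_of_hasDerivAt_solutionField (hI : IsOpen I) (hI' : IsPreconnected I)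
    {α : ℝ → Jet k} (hα : ∀ t ∈ I, HasDerivAt α (solutionField E (α t)) t) {t₀ : ℝ}
    (ht₀ : t₀ ∈ I) (h₀ : (α t₀).1 = t₀) :
    ContDiffOn ℝ k (fun t => (α t).2 0) I ∧ ∀ t ∈ I, jet k (fun t => (α t).2 0) t = α t := by
  have hfst : ∀ t ∈ I, (α t).1 = t :=
    eqOn_of_hasDerivAt_eq hI hI' (g := id)
      (fun t ht => by
        simpa [solutionField_fst] using (hα t ht).hasFDerivAt.fst.hasDerivAt)
      (fun t _ => hasDerivAt_id t) ht₀ h₀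
  have hsnd : ∀ i, ∀ t ∈ I, HasDerivAt (fun t => (α t).2 i) ((solutionField E (α t)).2 i) t :=
    fun i t ht => hasDerivAt_pi.1
      (by simpa using (hα t ht).hasFDerivAt.snd.hasDerivAt) i
  have hsucc : ∀ (i : Fin k), ∀ t ∈ I,
      HasDerivAt (fun t => (α t).2 i.castSucc) ((α t).2 i.succ) t := fun i t ht =>
    solutionField_snd_castSucc E (α t) i ▸ hsnd i.castSucc t ht
  exact ⟨contDiffOn_of_hasDerivAt_succ hI (y := fun i t => (α t).2 i) hsucc fun t ht =>
      (hsnd _ t ht).continuousAt.continuousWithinAt,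
    fun t ht => Prod.ext (hfst t ht).symm <| funext fun i =>
      iteratedDeriv_of_hasDerivAt_succ hI (y := fun i t => (α t).2 i) hsucc i t ht⟩

theorem IsODE.exists_isSolution (hE : IsODE k Ω E) (hq : q ∈ Ω) (h0 : E q = 0) :
    ∃ (I : Set ℝ) (f : ℝ → ℝ), IsSolution k Ω E I f ∧ q.1 ∈ I ∧ jet k f q.1 = q := by
  have hreg : fderiv ℝ E q (topDirection k) ≠ 0 := hE.regular q hq h0
  have hreg' : ∀ᶠ p in 𝓝 q, fderiv ℝ E p (topDirection k) ≠ 0 :=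
    (((hE.contDiffAt hq).fderiv_right (m := ∞) (by simp)).clm_apply
      contDiffAt_const).continuousAt.eventually_ne hreg
  obtain ⟨α, hα₀, δ, hδ, hα⟩ := exists_integralCurve_mem
    ((contDiffAt_solutionField (hE.contDiffAt hq) hreg).of_le (by simp))
    ((hE.isOpen.eventually_mem hq).and hreg') q.1
  set I := Metric.ball q.1 δ
  have hqI : q.1 ∈ I := Metric.mem_ball_self hδ
  have hI : IsConnected I := (convex_ball q.1 δ).isConnected ⟨q.1, hqI⟩
  obtain ⟨hsmooth, hjet⟩ := jet_eq_of_hasDerivAt_solutionField Metric.isOpen_ball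
    hI.isPreconnected (fun t ht => (hα t ht).1) hqI (congrArg Prod.fst hα₀)
  have hzero : ∀ t ∈ I, E (α t) = 0 :=
    eqOn_of_hasDerivAt_eq Metric.isOpen_ball hI.isPreconnected (g := fun _ => 0)
      (fun t ht => fderiv_solutionField (hα t ht).2.2 ▸
        ((hE.contDiffAt (hα t ht).2.1).differentiableAt (by simp)).hasFDerivAt.comp_hasDerivAt t
          (hα t ht).1)
      (fun t _ => hasDerivAt_const t 0) hqI (by rw [hα₀, h0])
  exact ⟨I, fun t => (α t).2 0,
    ⟨Metric.isOpen_ball, hI, hsmooth, fun t ht => hjet t ht ▸ (hα t ht).2.1,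
      fun t ht => hjet t ht ▸ hzero t ht⟩, hqI, (hjet _ hqI).trans hα₀⟩

end ExistsSolution

/-! ### Flows and rectifying coordinates -/

theorem injective_smul_rotate_add_smul {w : ℝ × ℝ} (hw : w ≠ 0) :
    Function.Injective (fun z : ℝ × ℝ => z.1 • (-w.2, w.1) + z.2 • w) := by
  rintro ⟨a, b⟩ ⟨a', b'⟩ h
  simp only [Prod.ext_iff, Prod.fst_add, Prod.snd_add, Prod.smul_fst, Prod.smul_snd,
    smul_eq_mul] at h
  have hnorm : w.1 ^ 2 + w.2 ^ 2 ≠ 0 := fun h0 =>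
    hw (Prod.ext (by simp; nlinarith) (by simp; nlinarith))
  exact Prod.ext
    (mul_left_cancel₀ hnorm (by linear_combination w.1 * h.2 - w.2 * h.1))
    (mul_left_cancel₀ hnorm (by linear_combination w.1 * h.1 + w.2 * h.2))

section Flow

variable {M : Set (ℝ × ℝ)} {dom : Set (ℝ × (ℝ × ℝ))} {Φ : ℝ → ℝ × ℝ → ℝ × ℝ}
  {v : ℝ × ℝ → ℝ × ℝ}

namespace IsLocalOneParameterGroup

theorem hasDerivAt (hΦ : IsLocalOneParameterGroup M dom Φ) (hv : IsGenerator M Φ v) {ε : ℝ}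
    {p : ℝ × ℝ} (h : (ε, p) ∈ dom) : HasDerivAt (fun t => Φ t p) (v (Φ ε p)) ε := by
  have hM := hΦ.mapsTo ε p h
  have hshift : HasDerivAt (fun δ => Φ (δ + ε) p) (v (Φ ε p)) 0 := by
    refine (hv _ hM).congr_of_eventuallyEq ?_
    have hδ : ∀ᶠ δ in 𝓝 (0 : ℝ), (δ, Φ ε p) ∈ dom :=
      (by fun_prop : ContinuousAt (fun δ : ℝ => (δ, Φ ε p)) 0).eventually
        (hΦ.isOpen_dom.mem_nhds (hΦ.zero_mem _ hM))
    have hδε : ∀ᶠ δ in 𝓝 (0 : ℝ), (δ + ε, p) ∈ dom :=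
      (by fun_prop : ContinuousAt (fun δ : ℝ => (δ + ε, p)) 0).eventually
        (hΦ.isOpen_dom.mem_nhds (by simpa using h))
    filter_upwards [hδ, hδε] with δ h₁ h₂
    exact (hΦ.map_add δ ε p h h₁ h₂).symm
  simpa using HasDerivAt.comp_sub_const (f := fun δ => Φ (δ + ε) p) ε ε (by simpa using hshift)

theorem contDiffOn_flow_line (hΦ : IsLocalOneParameterGroup M dom Φ) (p₀ u : ℝ × ℝ) :
    ContDiffOn ℝ ∞ (fun z : ℝ × ℝ => Φ z.2 (p₀ + z.1 • u)) {z | (z.2, p₀ + z.1 • u) ∈ dom} :=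
  hΦ.smooth.comp (f := fun z : ℝ × ℝ => (z.2, p₀ + z.1 • u))
    (contDiff_snd.prodMk (by fun_prop)).contDiffOn fun _ hz => hz

theorem fderiv_flow_line (hΦ : IsLocalOneParameterGroup M dom Φ) (hv : IsGenerator M Φ v)
    (p₀ u : ℝ × ℝ) {z : ℝ × ℝ} (hz : (z.2, p₀ + z.1 • u) ∈ dom)
    (hd : DifferentiableAt ℝ (fun z : ℝ × ℝ => Φ z.2 (p₀ + z.1 • u)) z) :
    fderiv ℝ (fun z : ℝ × ℝ => Φ z.2 (p₀ + z.1 • u)) z (0, 1) = v (Φ z.2 (p₀ + z.1 • u)) :=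
  (hd.hasFDerivAt.comp_hasDerivAt (f := fun t : ℝ => ((z.1, t) : ℝ × ℝ)) z.2
    ((hasDerivAt_const z.2 z.1).prodMk (hasDerivAt_id' z.2))).unique (hΦ.hasDerivAt hv hz)

theorem fderiv_flow_line_zero (hΦ : IsLocalOneParameterGroup M dom Φ) {p₀ : ℝ × ℝ} (hp₀ : p₀ ∈ M)
    (u : ℝ × ℝ) (hd : DifferentiableAt ℝ (fun z : ℝ × ℝ => Φ z.2 (p₀ + z.1 • u)) 0) :
    fderiv ℝ (fun z : ℝ × ℝ => Φ z.2 (p₀ + z.1 • u)) 0 (1, 0) = u := by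
  have hline : HasDerivAt (fun t : ℝ => p₀ + t • u) u 0 := by
    simpa using ((hasDerivAt_id (0 : ℝ)).smul_const u).const_add p₀
  refine (hd.hasFDerivAt.comp_hasDerivAt (f := fun t : ℝ => ((t, 0) : ℝ × ℝ)) (0 : ℝ)
    ((hasDerivAt_id' (0 : ℝ)).prodMk (hasDerivAt_const _ _))).unique
      (hline.congr_of_eventuallyEq ?_)
  filter_upwards [hline.continuousAt.eventually (hΦ.isOpen_space.mem_nhds (by simpa using hp₀))]
    with t ht
  exact hΦ.map_zero _ ht

theorem exists_rectifyingChart (hΦ : IsLocalOneParameterGroup M dom Φ) (hv : IsGenerator M Φ v)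
    {p₀ : ℝ × ℝ} (hp₀ : p₀ ∈ M) (hv₀ : v p₀ ≠ 0) :
    ∃ φ : OpenPartialHomeomorph (ℝ × ℝ) (ℝ × ℝ), IsRectifyingChart M v φ ∧ p₀ ∈ φ.source := by
  set u : ℝ × ℝ := (-(v p₀).2, (v p₀).1)
  set ψ : ℝ × ℝ → ℝ × ℝ := fun z => Φ z.2 (p₀ + z.1 • u)
  set S : Set (ℝ × ℝ) := {z | (z.2, p₀ + z.1 • u) ∈ dom}
  have hS : IsOpen S := hΦ.isOpen_dom.preimage (by fun_prop)
  have hψ : ContDiffOn ℝ ∞ ψ S := hΦ.contDiffOn_flow_line p₀ u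
  have hψd : ∀ z ∈ S, DifferentiableAt ℝ ψ z := fun z hz =>
    (hψ.contDiffAt (hS.mem_nhds hz)).differentiableAt (by simp)
  have h0S : (0 : ℝ × ℝ) ∈ S := by simpa [S] using hΦ.zero_mem p₀ hp₀
  have hψ0 : ψ 0 = p₀ := by simpa [ψ] using hΦ.map_zero p₀ hp₀
  have hfderiv : ∀ z, fderiv ℝ ψ 0 z = z.1 • u + z.2 • v p₀ := fun z => by
    rw [show z = z.1 • (1, 0) + z.2 • (0, 1) by simp, _root_.map_add, map_smul, map_smul,
      hΦ.fderiv_flow_line_zero hp₀ u (hψd 0 h0S), hΦ.fderiv_flow_line hv p₀ u h0S (hψd 0 h0S)]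
    change z.1 • u + z.2 • v (ψ 0) = _
    simp [hψ0]
  have hinj : Function.Injective (fderiv ℝ ψ 0) :=
    funext hfderiv ▸ injective_smul_rotate_add_smul hv₀
  let e : (ℝ × ℝ) ≃L[ℝ] ℝ × ℝ :=
    (LinearEquiv.ofInjectiveEndo (fderiv ℝ ψ 0).toLinearMap hinj).toContinuousLinearEquiv
  have he : HasFDerivAt ψ (e : ℝ × ℝ →L[ℝ] ℝ × ℝ) 0 := (hψd 0 h0S).hasFDerivAt
  obtain ⟨χ, hχ, hχψ, h0χ, hχS⟩ := exists_isSmoothChart_of_hasFDerivAt_equiv hS hψ h0S he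
  refine ⟨χ.symm, ⟨fun p hp => ?_, hχ.symm.smooth, hχ.symm.smooth_symm, fun p hp => ?_⟩, ?_⟩
  · rw [← χ.right_inv hp, hχψ]
    exact hΦ.mapsTo _ _ (hχS (χ.map_target hp))
  · have hz := χ.map_target hp
    have hflow : fderiv ℝ χ (χ.symm p) (0, 1) = v (χ (χ.symm p)) := by
      rw [hχψ]
      exact hΦ.fderiv_flow_line hv p₀ u (hχS hz) (hψd _ (hχS hz))
    have hleft := hχ.leftInverse_fderiv hz (0, 1)
    rwa [hflow, χ.right_inv hp] at hleft
  · rw [← hψ0, ← hχψ]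
    exact χ.map_source h0χ

end IsLocalOneParameterGroup

theorem IsRectifyingChart.eventually_flow {φ : OpenPartialHomeomorph (ℝ × ℝ) (ℝ × ℝ)}
    (hφ : IsRectifyingChart M v φ) (hΦ : IsLocalOneParameterGroup M dom Φ)
    (hv : IsGenerator M Φ v) {p₀ : ℝ × ℝ} (hp₀ : p₀ ∈ φ.source) :
    ∀ᶠ ε in 𝓝 (0 : ℝ), ∀ᶠ p in 𝓝 p₀, (ε, p) ∈ dom ∧ Φ ε p ∈ φ.source ∧
      φ (Φ ε p) = φ p + (0, ε) := by
  have hM := hφ.source_subset hp₀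
  have hmem : dom ∩ (fun z : ℝ × (ℝ × ℝ) => Φ z.1 z.2) ⁻¹' φ.source ∈ 𝓝 ((0 : ℝ), p₀) :=
    (hΦ.smooth.continuousOn.isOpen_inter_preimage hΦ.isOpen_dom φ.open_source).mem_nhds
      ⟨hΦ.zero_mem p₀ hM, by simpa [hΦ.map_zero p₀ hM] using hp₀⟩
  obtain ⟨A, hA, N, hN, hAN⟩ := mem_nhds_prod_iff.1 hmem
  obtain ⟨δ, hδ, hball⟩ := Metric.mem_nhds_iff.1 hA
  filter_upwards [Metric.ball_mem_nhds (0 : ℝ) hδ] with ε hε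
  filter_upwards [hN] with p hp
  have hflow : ∀ t ∈ Metric.ball (0 : ℝ) δ, (t, p) ∈ dom ∧ Φ t p ∈ φ.source := fun t ht =>
    hAN ⟨hball ht, hp⟩
  have h0 := Metric.mem_ball_self (x := (0 : ℝ)) hδ
  refine ⟨(hflow ε hε).1, (hflow ε hε).2, ?_⟩
  refine eqOn_of_hasDerivAt_eq (f := fun t => φ (Φ t p)) (g := fun t => φ p + (0, t))
    (d := fun _ => (0, 1)) Metric.isOpen_ball (convex_ball (0 : ℝ) δ).isPreconnected
    (fun t ht => ?_) (fun t _ => ?_) h0 ?_ hε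
  · rw [← hφ.rectifies _ (hflow t ht).2]
    exact (hφ.isSmoothChart.differentiableAt (hflow t ht).2).hasFDerivAt.comp_hasDerivAt t
      (hΦ.hasDerivAt hv (hflow t ht).1)
  · exact ((hasDerivAt_const t (0 : ℝ)).prodMk (hasDerivAt_id t)).const_add _
  · simp [hΦ.map_zero p (hΦ.mem_space 0 p (hflow 0 h0).1)]

end Flow

/-! ### Invariance under translations of `s` -/

section Translation

variable {φ : OpenPartialHomeomorph (ℝ × ℝ) (ℝ × ℝ)} {n : ℕ}

theorem IsSmoothChart.prolong_jet_of_translate (hφ : IsSmoothChart φ) {f f₁ : ℝ → ℝ}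
    {γ : ℝ → ℝ × ℝ} {x ε : ℝ} (hf : ContDiffAt ℝ (n + 1 : ℕ) f x)
    (hreg : jet (n + 1) f x ∈ regularJets φ n)
    (hγ : ∀ᶠ t in 𝓝 x, γ t ∈ φ.source ∧ φ (γ t) = φ (t, f t) + (0, ε))
    (hf₁ : ContDiffAt ℝ (n + 1 : ℕ) f₁ (γ x).1) (hgerm : IsGraphGerm γ f₁ x) :
    jet (n + 1) f₁ (γ x).1 ∈ regularJets φ n ∧ prolong φ (jet (n + 1) f₁ (γ x).1) =
      Jet.cons ((φ (x, f x)).2 + ε) (reducedJet φ (jet (n + 1) f x)) := by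
  obtain ⟨hp, h0⟩ := (hφ.jet_mem_regularJets_iff hf).1 hreg
  have hφf := hφ.contDiffAt_comp_graph hp hf
  obtain ⟨g, hgc, hg⟩ := exists_isGraphGerm hφf n.succ_ne_zero h0
  have hγx : γ x ∈ φ.source := hγ.self_of_nhds.1
  have hγc : ContDiffAt ℝ (n + 1 : ℕ) γ x :=
    hφ.contDiffAt_of_comp (hγ.mono fun _ ht => ht.1) <|
      (hφf.add contDiffAt_const).congr_of_eventuallyEq (hγ.mono fun _ ht => ht.2)
  have hpt : ((γ x).1, f₁ (γ x).1) = γ x := hgerm.eventuallyEq.eq_of_nhds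
  have hfst : (fun t => (φ (γ t)).1) =ᶠ[𝓝 x] fun t => (φ (t, f t)).1 :=
    hγ.mono fun t ht => by simp [ht.2]
  have hr : (φ (γ x)).1 = (φ (x, f x)).1 := hfst.eq_of_nhds
  have hderiv := hgerm.deriv_fst_comp (hφ.differentiableAt hγx)
    (hf₁.differentiableAt (by simp)) (hγc.differentiableAt (by simp))
  rw [hfst.deriv_eq] at hderiv
  have hreg₁ : jet (n + 1) f₁ (γ x).1 ∈ regularJets φ n :=
    (hφ.jet_mem_regularJets_iff hf₁).2 ⟨by rwa [hpt], left_ne_zero_of_mul (hderiv ▸ h0)⟩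
  have hgε : IsGraphGerm (fun r => φ (r, f₁ r)) (fun r => g r + ε) (γ x).1 := by
    refine hgerm.of_comp ?_ hγc n.succ_ne_zero (right_ne_zero_of_mul (hderiv ▸ h0))
    filter_upwards [hg, hγ] with t hgt ht
    simp [ht.2, hgt]
  refine ⟨hreg₁, ?_⟩
  rw [hgε.prolong_jet (by rw [hpt]; exact hφ.contDiffAt hγx) hf₁
    (by rw [hpt, hr]; exact hgc.add contDiffAt_const) hreg₁.2, hpt, hr, jet_succ_eq_cons,
    deriv_add_const', hg.self_of_nhds, hg.reducedJet_jet (hφ.contDiffAt hp) hf hgc hreg.2]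

variable {M : Set (ℝ × ℝ)} {dom : Set (ℝ × (ℝ × ℝ))} {Φ : ℝ → ℝ × ℝ → ℝ × ℝ}
  {v : ℝ × ℝ → ℝ × ℝ} {Ω : Set (Jet (n + 1))} {E : Jet (n + 1) → ℝ}

theorem IsSymmetryGroup.eventually_translate (hsymm : IsSymmetryGroup (n + 1) Ω E dom Φ)
    (hΦ : IsLocalOneParameterGroup M dom Φ) (hv : IsGenerator M Φ v) (hE : IsODE (n + 1) Ω E)
    (hφ : IsRectifyingChart M v φ) {q : Jet (n + 1)} (hq : q ∈ Ω) (hreg : q ∈ regularJets φ n)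
    (h0 : E q = 0) :
    ∀ᶠ ε in 𝓝 (0 : ℝ), ∃ q' ∈ regularJets φ n, E q' = 0 ∧
      prolong φ q' = Jet.cons ((φ q.base).2 + ε) (reducedJet φ q) := by
  obtain ⟨I, f, hf, hx, hfq⟩ := hE.exists_isSolution hq h0
  obtain ⟨I', -, hI', -, hxI', hsol⟩ := hsymm I f hf q.1 hx
  have hbase : q.base = (q.1, f q.1) := (congrArg Jet.base hfq).symm.trans (base_jet _ _ _)
  have hfx := hf.contDiffAt hx
  have hgraph : ContinuousAt (fun t => (t, f t)) q.1 := continuousAt_id.prodMk hfx.continuousAt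
  filter_upwards [hφ.eventually_flow hΦ hv (hbase ▸ hreg.1), hsol]
    with ε hflow ⟨_, I₁, f₁, himage, hf₁⟩
  have hmem : ∀ t ∈ I', (Φ ε (t, f t)).1 ∈ I₁ ∧ f₁ (Φ ε (t, f t)).1 = (Φ ε (t, f t)).2 :=
    fun t ht => by
      obtain ⟨x₁, hx₁, he⟩ : Φ ε (t, f t) ∈ graphOn f₁ I₁ :=
        himage ▸ mem_image_of_mem _ (mem_image_of_mem _ ht)
      rw [← he]
      exact ⟨hx₁, rfl⟩
  have hx₁ := (hmem q.1 hxI').1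
  obtain ⟨hreg₁, hprolong⟩ := hφ.isSmoothChart.prolong_jet_of_translate
    (γ := fun t => Φ ε (t, f t)) hfx (hfq.symm ▸ hreg)
    ((hgraph.eventually hflow).mono fun _ ht => ht.2) (hf₁.contDiffAt hx₁)
    (eventually_of_mem (hI'.mem_nhds hxI') fun t ht => (hmem t ht).2)
  exact ⟨_, hreg₁, hf₁.eq_zero _ hx₁, by rw [hprolong, hfq, hbase]⟩

end Translation

/-! ### The reduced equation -/

section Reduction

variable {M : Set (ℝ × ℝ)} {dom : Set (ℝ × (ℝ × ℝ))} {Φ : ℝ → ℝ × ℝ → ℝ × ℝ}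
  {v : ℝ × ℝ → ℝ × ℝ} {φ : OpenPartialHomeomorph (ℝ × ℝ) (ℝ × ℝ)} {n : ℕ}
  {Ω : Set (Jet (n + 1))} {E : Jet (n + 1) → ℝ} {D : Set (Jet n)} {J : Set ℝ}

theorem IsRectifyingChart.mem_regularJets_iff (hφ : IsRectifyingChart M v φ) {q : Jet (n + 1)} :
    q ∈ regularJets φ n ↔ q.base ∈ φ.source ∧ Transverse v q := by
  refine and_congr_right fun hq => ?_
  have hv := hφ.rectifies _ hq
  rw [totalDerivFst_eq (hφ.isSmoothChart.differentiableAt hq)]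
  constructor
  · intro h c hc
    rw [hc, map_smul, Prod.ext_iff] at hv
    obtain rfl : c = 0 := (mul_eq_zero.1 hv.1).resolve_right h
    simp at hv
  · intro h h0
    set b := (fderiv ℝ φ q.base (1, q.2 1)).2
    have htangent : b • v q.base = (1, q.2 1) := by
      refine (hφ.isSmoothChart.leftInverse_fderiv hq).injective ?_
      rw [map_smul, hv]
      exact Prod.ext (by simp [h0]) (by simp [b])
    have hb : b ≠ 0 := fun hb => by simp [hb, Prod.ext_iff] at htangent
    exact h b⁻¹ (by rw [← htangent, inv_smul_smul₀ hb])

theorem nowhereTangent_iff (n : ℕ) {I : Set ℝ} {f : ℝ → ℝ} :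
    NowhereTangent v I f ↔ ∀ x ∈ I, Transverse v (jet (n + 1) f x) := by
  simp [NowhereTangent, Transverse, jet, Jet.base]

theorem IsRectifyingChart.exists_isReductionDomain (hφ : IsRectifyingChart M v φ) (hΩ : IsOpen Ω)
    {q : Jet (n + 1)} (hq : q ∈ Ω) (hreg : q ∈ regularJets φ n) :
    ∃ (D : Set (Jet n)) (J : Set ℝ), IsReductionDomain Ω v φ D J ∧
      reducedJet φ q ∈ D ∧ (φ q.base).2 ∈ J := by
  have hφs := hφ.isSmoothChart
  obtain ⟨hreg', hinv⟩ := hφs.prolong_symm_prolong hreg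
  have hnear : ∀ᶠ c in 𝓝 (prolong φ q), c ∈ regularJets φ.symm n ∧ prolong φ.symm c ∈ Ω :=
    ((hφs.symm.isOpen_regularJets n).eventually_mem hreg').and
      ((contDiffAt_prolong (hφs.symm.contDiffAt hreg'.1) hreg'.2).continuousAt.eventually
        (hΩ.mem_nhds (by rwa [hinv])))
  rw [prolong_eq_cons] at hnear
  obtain ⟨A, hA, B, hB, hAB⟩ := mem_nhds_prod_iff.1 <|
    (Jet.contDiff_cons.continuous.continuousAt (x := ((φ q.base).2, reducedJet φ q))).eventually
      hnear
  obtain ⟨δ, hδ, hball⟩ := Metric.mem_nhds_iff.1 hA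
  obtain ⟨D, hDB, hD, hqD⟩ := mem_nhds_iff.1 hB
  refine ⟨D, Metric.ball (φ q.base).2 δ, ⟨hD, Metric.isOpen_ball,
    (convex_ball _ δ).isConnected ⟨_, Metric.mem_ball_self hδ⟩, fun w hw s hs => ?_⟩, hqD,
    Metric.mem_ball_self hδ⟩
  obtain ⟨hws, hΩ'⟩ := hAB (mk_mem_prod (hball hs) (hDB hw))
  obtain ⟨hreg'', hprolong⟩ := hφs.prolong_prolong_symm hws
  rw [prolong_eq_cons, Jet.cons_inj] at hprolong
  obtain ⟨hsource, htransverse⟩ := hφ.mem_regularJets_iff.1 hreg''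
  exact ⟨_, hΩ', hsource, htransverse, hprolong⟩

namespace IsReductionDomain

theorem prolong_symm_mem (hD : IsReductionDomain Ω v φ D J) (hφ : IsRectifyingChart M v φ)
    {w : Jet n} (hw : w ∈ D) {s : ℝ} (hs : s ∈ J) :
    Jet.cons s w ∈ regularJets φ.symm n ∧ prolong φ.symm (Jet.cons s w) ∈ Ω := by
  obtain ⟨q, hq, hsource, htransverse, rfl, rfl⟩ := hD.exists_jet w hw s hs
  obtain ⟨hreg, hinv⟩ := hφ.isSmoothChart.prolong_symm_prolong
    (hφ.mem_regularJets_iff.2 ⟨hsource, htransverse⟩)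
  rw [prolong_eq_cons φ] at hreg hinv
  exact ⟨hreg, by rwa [hinv]⟩

theorem contDiffAt_prolong_symm (hD : IsReductionDomain Ω v φ D J)
    (hφ : IsRectifyingChart M v φ) (hE : IsODE (n + 1) Ω E) {w : Jet n} (hw : w ∈ D) {s : ℝ}
    (hs : s ∈ J) :
    ContDiffAt ℝ ∞ (fun z : ℝ × Jet n => E (prolong φ.symm (Jet.cons z.1 z.2))) (s, w) := by
  obtain ⟨hreg, hΩ⟩ := hD.prolong_symm_mem hφ hw hs
  have hprolong := contDiffAt_prolong (hφ.isSmoothChart.symm.contDiffAt hreg.1) hreg.2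
  exact ContDiffAt.comp (s, w) (g := fun c => E (prolong φ.symm c))
    (ContDiffAt.comp (Jet.cons s w) (hE.contDiffAt hΩ) hprolong) Jet.contDiff_cons.contDiffAt

theorem eq_zero_of_eq_zero (hD : IsReductionDomain Ω v φ D J)
    (hΦ : IsLocalOneParameterGroup M dom Φ) (hv : IsGenerator M Φ v) (hE : IsODE (n + 1) Ω E)
    (hsymm : IsSymmetryGroup (n + 1) Ω E dom Φ) (hφ : IsRectifyingChart M v φ) {w : Jet n}
    (hw : w ∈ D) {s s' : ℝ} (hs : s ∈ J) (hs' : s' ∈ J)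
    (h : E (prolong φ.symm (Jet.cons s w)) = 0) : E (prolong φ.symm (Jet.cons s' w)) = 0 := by
  refine eq_of_locally_eq (h := fun t => E (prolong φ.symm (Jet.cons t w)))
    hD.isConnected.isPreconnected (fun t ht => ?_) (fun t ht h0 => ?_) hs hs' h
  · exact ((hD.contDiffAt_prolong_symm hφ hE hw ht).continuousAt.comp
      (f := fun t => (t, w)) (by fun_prop)).continuousWithinAt
  · obtain ⟨hreg, hΩ⟩ := hD.prolong_symm_mem hφ hw ht
    obtain ⟨hreg', hinv⟩ := hφ.isSmoothChart.prolong_prolong_symm hreg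
    rw [prolong_eq_cons φ, Jet.cons_inj] at hinv
    have htranslate := hsymm.eventually_translate hΦ hv hE hφ hΩ hreg' h0
    rw [hinv.1, hinv.2] at htranslate
    have hsub : Tendsto (fun t' : ℝ => t' - t) (𝓝[J] t) (𝓝 0) :=
      tendsto_nhdsWithin_of_tendsto_nhds (tendsto_sub_nhds_zero_iff.2 tendsto_id)
    filter_upwards [hsub.eventually htranslate] with t' ⟨q, hq, hq0, hprolong⟩
    rw [add_sub_cancel] at hprolong
    rwa [← hprolong, (hφ.isSmoothChart.prolong_symm_prolong hq).2]

end IsReductionDomain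

/-- The equation `E = 0` in the coordinates `φ = (r, s)`, at a fixed value of `s`. -/
noncomputable def reducedEquation (φ : OpenPartialHomeomorph (ℝ × ℝ) (ℝ × ℝ))
    (E : Jet (n + 1) → ℝ) (s : ℝ) (w : Jet n) : ℝ :=
  E (prolong φ.symm (Jet.cons s w))

theorem IsReductionDomain.isODE_reducedEquation (hD : IsReductionDomain Ω v φ D J)
    (hφ : IsRectifyingChart M v φ) (hE : IsODE (n + 1) Ω E) {s : ℝ} (hs : s ∈ J) :
    IsODE n D (reducedEquation φ E s) := by
  have hsmooth : ∀ w ∈ D, ContDiffAt ℝ ∞ (reducedEquation φ E s) w := fun w hw =>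
    (hD.contDiffAt_prolong_symm hφ hE hw hs).comp (f := fun w => (s, w)) w
      (contDiffAt_const.prodMk contDiffAt_id)
  refine ⟨hD.isOpen, fun w hw => (hsmooth w hw).contDiffWithinAt, fun w hw h0 => ?_⟩
  obtain ⟨hreg, hΩ⟩ := hD.prolong_symm_mem hφ hw hs
  have hφs := hφ.isSmoothChart.symm
  obtain ⟨κ, hκ, hκe⟩ := hφs.fderiv_prolong_topDirection hreg
  have hcomp := ((hE.contDiffAt hΩ).differentiableAt (by simp)).hasFDerivAt.comp (Jet.cons s w)
    ((contDiffAt_prolong (hφs.contDiffAt hreg.1) hreg.2).differentiableAt (by simp)).hasFDerivAt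
  have hline : HasLineDerivAt ℝ (reducedEquation φ E s)
      (fderiv ℝ E (prolong φ.symm (Jet.cons s w)) (κ • topDirection (n + 1))) w
      (topDirection n) := by
    rw [← hκe]
    have hderiv := hcomp.hasLineDerivAt (topDirection (n + 1))
    simp only [HasLineDerivAt, ← Jet.cons_add_smul_topDirection] at hderiv
    exact hderiv
  change fderiv ℝ (reducedEquation φ E s) w (topDirection n) ≠ 0
  rw [← ((hsmooth w hw).differentiableAt (by simp)).lineDeriv_eq_fderiv, hline.lineDeriv, map_smul]
  exact smul_ne_zero hκ (hE.regular _ hΩ h0)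

/-- On the jets with coordinates in `D` and `J`, the equation `E = 0` takes in the coordinates
`φ = (r, s)` the form `R = 0`, which does not involve `s`. -/
def IsReducedEquation (Ω : Set (Jet (n + 1))) (E : Jet (n + 1) → ℝ)
    (φ : OpenPartialHomeomorph (ℝ × ℝ) (ℝ × ℝ)) (D : Set (Jet n)) (J : Set ℝ)
    (R : Jet n → ℝ) : Prop :=
  ∀ q ∈ Ω, q ∈ regularJets φ n → (φ q.base).2 ∈ J → reducedJet φ q ∈ D →
    (E q = 0 ↔ R (reducedJet φ q) = 0)

theorem IsReductionDomain.isReducedEquation (hD : IsReductionDomain Ω v φ D J)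
    (hΦ : IsLocalOneParameterGroup M dom Φ) (hv : IsGenerator M Φ v) (hE : IsODE (n + 1) Ω E)
    (hsymm : IsSymmetryGroup (n + 1) Ω E dom Φ) (hφ : IsRectifyingChart M v φ) {s : ℝ}
    (hs : s ∈ J) : IsReducedEquation Ω E φ D J (reducedEquation φ E s) := by
  intro q _ hreg hqJ hqD
  have hinv := (hφ.isSmoothChart.prolong_symm_prolong hreg).2
  rw [prolong_eq_cons φ] at hinv
  nth_rewrite 1 [← hinv]
  exact ⟨hD.eq_zero_of_eq_zero hΦ hv hE hsymm hφ hqD hqJ hs,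
    hD.eq_zero_of_eq_zero hΦ hv hE hsymm hφ hqD hs hqJ⟩

/-! ### Quadrature -/

section Quadrature

variable {I : Set ℝ} {f : ℝ → ℝ}

theorem IsSmoothChart.exists_prolong_jet_eq (hφ : IsSmoothChart φ) (hI : IsOpen I)
    (hI' : IsConnected I) (hf : ContDiffOn ℝ (n + 1 : ℕ) f I)
    (hreg : ∀ x ∈ I, jet (n + 1) f x ∈ regularJets φ n) :
    InjOn (fun x => (φ (x, f x)).1) I ∧ IsOpen ((fun x => (φ (x, f x)).1) '' I) ∧
      IsConnected ((fun x => (φ (x, f x)).1) '' I) ∧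
      ∃ g : ℝ → ℝ, ContDiffOn ℝ (n + 1 : ℕ) g ((fun x => (φ (x, f x)).1) '' I) ∧
        ∀ x ∈ I, prolong φ (jet (n + 1) f x) = jet (n + 1) g (φ (x, f x)).1 := by
  have hfAt : ∀ x ∈ I, ContDiffAt ℝ (n + 1 : ℕ) f x := fun x hx =>
    hf.contDiffAt (hI.mem_nhds hx)
  have hcurve : ∀ x ∈ I, (x, f x) ∈ φ.source ∧ deriv (fun t => (φ (t, f t)).1) x ≠ 0 :=
    fun x hx => (hφ.jet_mem_regularJets_iff (hfAt x hx)).1 (hreg x hx)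
  obtain ⟨hinj, hopen, hconn, g, hg, hgerm⟩ := exists_contDiffOn_graph hI hI'
    (fun x hx => hφ.contDiffAt_comp_graph (hcurve x hx).1 (hfAt x hx)) n.succ_ne_zero
    fun x hx => (hcurve x hx).2
  exact ⟨hinj, hopen, hconn, g, hg, fun x hx => (hgerm x hx).prolong_jet
    (hφ.contDiffAt (hcurve x hx).1) (hfAt x hx)
    (hg.contDiffAt (hopen.mem_nhds (mem_image_of_mem _ hx))) (hreg x hx).2⟩

theorem graphOn_eq_symm_image {σ : ℝ → ℝ} (hsource : ∀ x ∈ I, (x, f x) ∈ φ.source)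
    (hσ : ∀ x ∈ I, σ (φ (x, f x)).1 = (φ (x, f x)).2) :
    graphOn f I = φ.symm '' graphOn σ ((fun x => (φ (x, f x)).1) '' I) := by
  simp only [graphOn, image_image]
  refine image_congr fun x hx => ?_
  rw [hσ x hx, Prod.mk.eta, φ.left_inv (hsource x hx)]

theorem IsSmoothChart.exists_quadrature (hφ : IsSmoothChart φ) (hI : IsOpen I)
    (hI' : IsConnected I) (hf : ContDiffOn ℝ (n + 1 : ℕ) f I)
    (hreg : ∀ x ∈ I, jet (n + 1) f x ∈ regularJets φ n) :
    ∃ θ : ℝ → ℝ, InjOn (fun x => (φ (x, f x)).1) I ∧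
      ContDiffOn ℝ n θ ((fun x => (φ (x, f x)).1) '' I) ∧
      (∀ x ∈ I, jet n θ (φ (x, f x)).1 = reducedJet φ (jet (n + 1) f x)) ∧
      ∀ x₁ ∈ I, graphOn f I =
        φ.symm '' graphOn (fun r => (φ (x₁, f x₁)).2 + ∫ t in (φ (x₁, f x₁)).1..r, θ t)
          ((fun x => (φ (x, f x)).1) '' I) := by
  obtain ⟨hinj, hopen, hconn, g, hg, hjet⟩ := hφ.exists_prolong_jet_eq hI hI' hf hreg
  have hcons : ∀ x ∈ I, (φ (x, f x)).2 = g (φ (x, f x)).1 ∧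
      reducedJet φ (jet (n + 1) f x) = jet n (deriv g) (φ (x, f x)).1 := fun x hx => by
    simpa only [prolong_eq_cons, jet_succ_eq_cons n g, Jet.cons_inj, base_jet] using hjet x hx
  refine ⟨deriv g, hinj, ?_, fun x hx => (hcons x hx).2.symm, fun x₁ hx₁ =>
    graphOn_eq_symm_image (fun x hx => base_jet (n + 1) f x ▸ (hreg x hx).1) fun x hx => ?_⟩
  · exact ((contDiffOn_succ_iff_deriv_of_isOpen hopen).1 (by exact_mod_cast hg)).2.2
  · rw [(hcons x₁ hx₁).1, (hcons x hx).1]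
    exact add_integral_deriv_eq hopen hconn.isPreconnected (hg.of_le (by simp))
      (mem_image_of_mem _ hx₁) (mem_image_of_mem _ hx)

variable {R : Jet n → ℝ} {θ : ℝ → ℝ}

theorem IsReducedEquation.isSolution (hR : IsReducedEquation Ω E φ D J R) (hφ : IsSmoothChart φ)
    (hf : IsSolution (n + 1) Ω E I f) (hreg : ∀ x ∈ I, jet (n + 1) f x ∈ regularJets φ n)
    (hθ : ContDiffOn ℝ n θ ((fun x => (φ (x, f x)).1) '' I))
    (hjet : ∀ x ∈ I, jet n θ (φ (x, f x)).1 = reducedJet φ (jet (n + 1) f x))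
    (hmem : ∀ x ∈ I, reducedJet φ (jet (n + 1) f x) ∈ D ∧ (φ (x, f x)).2 ∈ J) :
    IsSolution n D R ((fun x => (φ (x, f x)).1) '' I) θ := by
  obtain ⟨-, hopen, hconn, -⟩ :=
    hφ.exists_prolong_jet_eq hf.isOpen hf.isConnected hf.contDiffOn hreg
  refine ⟨hopen, hconn, hθ, forall_mem_image.2 fun x hx => ?_, forall_mem_image.2 fun x hx => ?_⟩
  · rw [hjet x hx]
    exact (hmem x hx).1
  · rw [hjet x hx]
    exact (hR _ (hf.mem x hx) (hreg x hx) (by rw [base_jet]; exact (hmem x hx).2)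
      (hmem x hx).1).1 (hf.eq_zero x hx)

theorem IsReducedEquation.exists_isSolution (hR : IsReducedEquation Ω E φ D J R)
    (hφ : IsRectifyingChart M v φ) (hD : IsReductionDomain Ω v φ D J) {K : Set ℝ}
    (hθ : IsSolution n D R K θ) {σ : ℝ → ℝ} (hσ : ∀ r ∈ K, HasDerivAt σ (θ r) r)
    (hσJ : ∀ r ∈ K, σ r ∈ J) :
    (∀ r ∈ K, (r, σ r) ∈ φ.target) ∧
      ∃ (I : Set ℝ) (f : ℝ → ℝ), IsSolution (n + 1) Ω E I f ∧ NowhereTangent v I f ∧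
        graphOn f I = φ.symm '' graphOn σ K := by
  have hφs := hφ.isSmoothChart
  have hcons : ∀ r ∈ K, jet (n + 1) σ r = Jet.cons (σ r) (jet n θ r) := fun r hr =>
    jet_succ_eq_cons_of_hasDerivAt hθ.isOpen hσ n hr
  have hmem : ∀ r ∈ K, jet (n + 1) σ r ∈ regularJets φ.symm n ∧
      prolong φ.symm (jet (n + 1) σ r) ∈ Ω := fun r hr => by
    rw [hcons r hr]
    exact hD.prolong_symm_mem hφ (hθ.mem r hr) (hσJ r hr)
  obtain ⟨-, hopen, hconn, f, hf, hjet⟩ := hφs.symm.exists_prolong_jet_eq hθ.isOpen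
    hθ.isConnected (contDiffOn_succ_of_hasDerivAt hθ.isOpen hθ.contDiffOn hσ)
    fun r hr => (hmem r hr).1
  have hfΩ : ∀ r ∈ K, jet (n + 1) f (φ.symm (r, σ r)).1 ∈ Ω := fun r hr =>
    hjet r hr ▸ (hmem r hr).2
  have hreg : ∀ r ∈ K, jet (n + 1) f (φ.symm (r, σ r)).1 ∈ regularJets φ n := fun r hr =>
    hjet r hr ▸ (hφs.prolong_prolong_symm (hmem r hr).1).1
  have hreduced : ∀ r ∈ K, (φ (jet (n + 1) f (φ.symm (r, σ r)).1).base).2 = σ r ∧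
      reducedJet φ (jet (n + 1) f (φ.symm (r, σ r)).1) = jet n θ r := fun r hr => by
    have hinv := (hφs.prolong_prolong_symm (hmem r hr).1).2
    rwa [hjet r hr, hcons r hr, prolong_eq_cons, Jet.cons_inj] at hinv
  refine ⟨fun r hr => base_jet (n + 1) σ r ▸ (hmem r hr).1.1, _, f,
    ⟨hopen, hconn, hf, forall_mem_image.2 hfΩ, forall_mem_image.2 fun r hr => ?_⟩,
    (nowhereTangent_iff n).2 (forall_mem_image.2 fun r hr => ?_), ?_⟩
  · refine (hR _ (hfΩ r hr) (hreg r hr) ?_ ?_).2 ?_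
    · rw [(hreduced r hr).1]
      exact hσJ r hr
    · rw [(hreduced r hr).2]
      exact hθ.mem r hr
    · rw [(hreduced r hr).2]
      exact hθ.eq_zero r hr
  · exact (hφ.mem_regularJets_iff.1 (hreg r hr)).2
  · simp only [graphOn, image_image]
    refine image_congr fun r hr => ?_
    have hbase := congrArg Jet.base (hjet r hr)
    rw [base_jet] at hbase
    exact hbase.symm.trans (congrArg φ.symm (base_jet (n + 1) σ r))

end Quadrature

end Reduction

end ODEReduction

theorem mainTheorem1 (n : ℕ)
    (M : Set (ℝ × ℝ)) (dom : Set (ℝ × (ℝ × ℝ))) (Φ : ℝ → ℝ × ℝ → ℝ × ℝ)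
    (hΦ : IsLocalOneParameterGroup M dom Φ)
    (v : ℝ × ℝ → ℝ × ℝ) (hv : IsGenerator M Φ v)
    (Ω : Set (Jet (n + 1))) (hΩM : ∀ q ∈ Ω, q.base ∈ M)
    (E : Jet (n + 1) → ℝ) (hE : IsODE (n + 1) Ω E)
    (hsymm : IsSymmetryGroup (n + 1) Ω E dom Φ) :
    -- rectifying coordinates exist near every point where `v` does not vanish
    (∀ p ∈ M, v p ≠ 0 →
      ∃ φ : OpenPartialHomeomorph (ℝ × ℝ) (ℝ × ℝ), IsRectifyingChart M v φ ∧ p ∈ φ.source) ∧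
    ∀ φ : OpenPartialHomeomorph (ℝ × ℝ) (ℝ × ℝ), IsRectifyingChart M v φ →
      -- the reduction domains cover the jets that are transverse to `v`
      (∀ q ∈ Ω, q.base ∈ φ.source → Transverse v q →
        ∃ (D : Set (Jet n)) (J : Set ℝ), IsReductionDomain Ω v φ D J ∧
          reducedJet φ q ∈ D ∧ (φ q.base).2 ∈ J) ∧
      ∀ (D : Set (Jet n)) (J : Set ℝ), IsReductionDomain Ω v φ D J →
        -- the reduced equation `R(r, z, …, z_n) = 0`, of order `n`
        ∃ R : Jet n → ℝ, IsODE n D R ∧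
          -- it is the given equation, which does not involve `s` in the coordinates `(r, s)`
          (∀ q ∈ Ω, q.base ∈ φ.source → Transverse v q → (φ q.base).2 ∈ J →
            reducedJet φ q ∈ D → (E q = 0 ↔ R (reducedJet φ q) = 0)) ∧
          -- every nontangential solution is obtained by one quadrature from a solution `θ` of it
          (∀ (I : Set ℝ) (f : ℝ → ℝ), IsSolution (n + 1) Ω E I f → NowhereTangent v I f →
            (∀ x ∈ I, (x, f x) ∈ φ.source) →
            ∃ θ : ℝ → ℝ,
              InjOn (fun x => (φ (x, f x)).1) I ∧
              ContDiffOn ℝ n θ ((fun x => (φ (x, f x)).1) '' I) ∧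
              (∀ x ∈ I, jet n θ (φ (x, f x)).1 = reducedJet φ (jet (n + 1) f x)) ∧
              (∀ I' ⊆ I, IsOpen I' → IsConnected I' →
                (∀ x ∈ I', reducedJet φ (jet (n + 1) f x) ∈ D ∧ (φ (x, f x)).2 ∈ J) →
                IsSolution n D R ((fun x => (φ (x, f x)).1) '' I') θ) ∧
              ∀ x₁ ∈ I, graphOn f I =
                φ.symm '' graphOn
                  (fun r => (φ (x₁, f x₁)).2 + ∫ t in (φ (x₁, f x₁)).1..r, θ t)
                  ((fun x => (φ (x, f x)).1) '' I)) ∧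
          -- conversely, one quadrature of a solution `θ` of it yields a nontangential solution
          (∀ (K : Set ℝ) (θ : ℝ → ℝ), IsSolution n D R K θ → ∀ r₁ ∈ K, ∀ c : ℝ,
            (∀ r ∈ K, c + ∫ t in r₁..r, θ t ∈ J) →
            (∀ r ∈ K, (r, c + ∫ t in r₁..r, θ t) ∈ φ.target) ∧
            ∃ (I : Set ℝ) (f : ℝ → ℝ), IsSolution (n + 1) Ω E I f ∧ NowhereTangent v I f ∧
              graphOn f I = φ.symm '' graphOn (fun r => c + ∫ t in r₁..r, θ t) K) := by
  refine ⟨fun p hp hvp => hΦ.exists_rectifyingChart hv hp hvp, fun φ hφ =>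
    ⟨fun q hq hqs hqt => hφ.exists_isReductionDomain hE.isOpen hq
      (hφ.mem_regularJets_iff.2 ⟨hqs, hqt⟩), fun D J hD => ?_⟩⟩
  obtain ⟨s₀, hs₀⟩ := hD.isConnected.nonempty
  have hR := hD.isReducedEquation hΦ hv hE hsymm hφ hs₀
  refine ⟨reducedEquation φ E s₀, hD.isODE_reducedEquation hφ hE hs₀,
    fun q hq hqs hqt => hR q hq (hφ.mem_regularJets_iff.2 ⟨hqs, hqt⟩),
    fun I f hf hft hfs => ?_, fun K θ hθ r₁ hr₁ c hJ => ?_⟩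
  · have hreg : ∀ x ∈ I, jet (n + 1) f x ∈ regularJets φ n := fun x hx =>
      hφ.mem_regularJets_iff.2
        ⟨by rw [base_jet]; exact hfs x hx, (nowhereTangent_iff n).1 hft x hx⟩
    obtain ⟨θ, hinj, hθ, hjet, hgraph⟩ :=
      hφ.isSmoothChart.exists_quadrature hf.isOpen hf.isConnected hf.contDiffOn hreg
    exact ⟨θ, hinj, hθ, hjet, fun I' hI'I hI' hI'c hmem =>
      hR.isSolution hφ.isSmoothChart (hf.mono hI'I hI' hI'c) (fun x hx => hreg x (hI'I hx))
        (hθ.mono (image_mono hI'I)) (fun x hx => hjet x (hI'I hx)) hmem, hgraph⟩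
  · exact hR.exists_isSolution hφ hD hθ (fun r hr => hasDerivAt_add_integral hθ.isOpen
      hθ.isConnected.isPreconnected hθ.contDiffOn.continuousOn hr₁ c hr) hJ
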